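/- Let $0<p\le 1$ and let $Y=(Y_0,Y_1,Y_2,\dots)$ be independent integer-valued random variables with $Y_t\ge 2$ (almost surely) for all $t$, with $\mathbb{E}[Y_t]=\mu$ for all $t\ge 1$, where $\mu$ does not depend on $t$, and with $2<Y_t<t^{1/3}$ (almost surely) for all sufficiently large $t$. The $Y_t$ need not be identically distributed. In a hypergraph, hyperedges are finite multisets of vertices (a vertex may occur several times in a hyperedge), and hyperedges that arrive at different times are counted separately. The degree of a vertex is the number of hyperedges that contain it; a hyperedge in which the vertex occurs several times contributes $1$. The random hypergraph process $H(H_0,p,Y)$ is defined as follows. $H_0$ has a single vertex and a single hyperedge of cardinality $Y_0$ over this vertex. For $t\ge 1$, $H_t$ arises from $H_{t-1}$: with probability $p$, a new vertex $u$ is added, together with a new hyperedge that consists of $u$ and $Y_t-1$ vertices of $H_{t-1}$; otherwise (with probability $1-p$) only a new hyperedge is added, which consists of $Y_t$ vertices of $H_{t-1}$. In both cases the vertices of $H_{t-1}$ are selected independently, possibly with repetitions, each with probability proportional to its degree in $H_{t-1}$. The bits and the selections are made independently of $Y$, apart from the number of vertices selected. Let $m_{k,t}$ be the number of vertices of degree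 $k$ in $H_t$. Then $\mathbb{E}[m_{k,t}]$ is finite for all $k,t\ge 0$; for every $k\ge 1$ the limit $$M_k=\lim_{t\to\infty}\frac{\mathbb{E}[m_{k,t}]}{t}$$ exists, with $$M_1=\frac{\mu p}{2\mu-p},\qquad M_k=M_{k-1}\,\frac{k-1}{k+\frac{\mu}{\mu-p}}\quad(k\ge 2);$$ and the degree distribution follows a power law with exponent $\beta=2+\frac{p}{\mu-p}$, that is, there is a constant $c>0$ such that $M_k\sim c\,k^{-\beta}$ as $k\to\infty$. -/

import Mathlib

open MeasureTheory ProbabilityTheory Filter Topology Asymptotics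
open scoped NNReal ENNReal

noncomputable section

/-- A finite nonempty hypergraph with vertex set `Fin order`. A hyperedge is a multiset of vertices
(self loops, that is, repeated vertices in a hyperedge, are allowed), and the hyperedges form a
multiset (two hyperedges that arrive at different times count as two, even if they have the same
members). -/
structure MHypergraph where
  order : ℕ
  order_pos : 0 < order
  edges : Multiset (Multiset (Fin order))

namespace MHypergraph

/-- The degree of `v` is the number of hyperedges that contain `v`; a hyperedge in which `v` appears
several times contributes 1. -/
def degree (H : MHypergraph) (v : Fin H.order) : ℕ :=
  H.edges.countP (fun e => v ∈ e)

/-- The sum of all vertex degrees. -/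
def totalDegree (H : MHypergraph) : ℕ := ∑ v, H.degree v

/-- The number of vertices of degree `k`. -/
def degreeCount (H : MHypergraph) (k : ℕ) : ℕ :=
  (Finset.univ.filter (fun v => H.degree v = k)).card

/-- The hypergraph on a single vertex with a single hyperedge of cardinality `y`, all of whose
members are that vertex. -/
def initial (y : ℕ) : MHypergraph where
  order := 1
  order_pos := Nat.one_pos
  edges := {Multiset.replicate y 0}

/-- Hyperedge arrival: add the hyperedge `s` of existing vertices. -/
def addEdge (H : MHypergraph) (s : Multiset (Fin H.order)) : MHypergraph where
  order := H.order
  order_pos := H.order_pos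
  edges := s ::ₘ H.edges

/-- Vertex arrival: add a new vertex (the last one of `Fin (order + 1)`), and a hyperedge
consisting of the new vertex and the multiset `s` of old vertices. -/
def addVertex (H : MHypergraph) (s : Multiset (Fin H.order)) : MHypergraph where
  order := H.order + 1
  order_pos := Nat.succ_pos _
  edges := (Fin.last H.order ::ₘ s.map Fin.castSucc) ::ₘ
    H.edges.map (fun e => e.map Fin.castSucc)

open Classical in
/-- A random vertex of `H`: the vertex `v` is selected with probability
`degree v / totalDegree`. (The `else` branch only gives a value to the case in which all
degrees vanish; no hypergraph of the process below is of this kind, if its initial hyperedge is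
nonempty.) -/
def selectVertex (H : MHypergraph) : PMF (Fin H.order) :=
  if h : H.totalDegree ≠ 0 then
    PMF.ofFintype (fun v => (H.degree v : ℝ≥0∞) / (H.totalDegree : ℝ≥0∞)) (by
      simp only [div_eq_mul_inv]
      rw [← Finset.sum_mul, ← Nat.cast_sum]
      exact ENNReal.mul_inv_cancel (by exact_mod_cast h) (ENNReal.natCast_ne_top _))
  else PMF.pure ⟨0, H.order_pos⟩

/-- The multiset of `j` vertices of `H` that are selected independently (with repetitions), each one
in proportion to the degrees in `H`. -/
def selectVertices (H : MHypergraph) : ℕ → PMF (Multiset (Fin H.order))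
  | 0 => PMF.pure 0
  | j + 1 => H.selectVertex.bind fun v => (H.selectVertices j).map fun s => v ::ₘ s

/-- The random bit that decides on the kind of event: `true` (vertex arrival) has probability `p`,
`false` (hyperedge arrival) has probability `1 - p`. -/
def arrivalBit (p : ℝ≥0) (hp : p ≤ 1) : PMF Bool :=
  PMF.ofFintype (fun b => if b then (p : ℝ≥0∞) else ((1 - p : ℝ≥0) : ℝ≥0∞)) (by
    simp only [Fintype.univ_bool, Finset.mem_singleton, Bool.true_eq_false, not_false_eq_true,
      Finset.sum_insert, Finset.sum_singleton, if_true, Bool.false_eq_true, if_false]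
    rw [← ENNReal.coe_add, add_tsub_cancel_of_le hp, ENNReal.coe_one])

/-- The law of the next hypergraph, if the present one is `H` and the arriving hyperedge has
cardinality `y`: with probability `p` a new vertex arrives in a hyperedge with `y - 1` selected
vertices, otherwise a hyperedge of `y` selected vertices arrives. -/
def step (p : ℝ≥0) (hp : p ≤ 1) (y : ℕ) (H : MHypergraph) : PMF MHypergraph :=
  (arrivalBit p hp).bind fun b =>
    if b then (H.selectVertices (y - 1)).map H.addVertex
    else (H.selectVertices y).map H.addEdge

/-- The law of the hypergraph at time `t`, given that the cardinalities of the initial hyperedge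
and of the arriving hyperedges are `y 0, y 1, y 2, …`. -/
def lawAt (p : ℝ≥0) (hp : p ≤ 1) (y : ℕ → ℕ) : ℕ → PMF MHypergraph
  | 0 => PMF.pure (initial (y 0))
  | t + 1 => (lawAt p hp y t).bind (step p hp (y (t + 1)))

/-- `E[m_{k,t}]`, the expected number of vertices of degree `k` at time `t`, for the process
with random hyperedge cardinalities `Y 0, Y 1, Y 2, …` on the probability space `(Ω, P)`: the
conditional expectation given `Y` is taken with respect to `lawAt`, and then averaged over `Y`. -/
def expectedDegreeCount {Ω : Type*} [MeasurableSpace Ω] (P : Measure Ω) (p : ℝ≥0) (hp : p ≤ 1)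
    (Y : ℕ → Ω → ℕ) (k t : ℕ) : ℝ≥0∞ :=
  ∫⁻ ω, ∑' H : MHypergraph, lawAt p hp (fun i => Y i ω) t H * (H.degreeCount k : ℝ≥0∞) ∂P

end MHypergraph

/-- The sequence `M` follows a power law with exponent `β`: for some constant `c > 0`, `M k` is
asymptotically equivalent to `c * k ^ (-β)` for large `k`. -/
def FollowsPowerLaw (M : ℕ → ℝ) (β : ℝ) : Prop :=
  ∃ c : ℝ, 0 < c ∧ M ~[atTop] fun k : ℕ => c * (k : ℝ) ^ (-β)

end

noncomputable section

namespace MHypergraph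

/-! ### Degrees after an arrival -/

lemma degree_addEdge (H : MHypergraph) (s : Multiset (Fin H.order)) (v : Fin H.order) :
    (H.addEdge s).degree v = H.degree v + if v ∈ s then 1 else 0 := by
  unfold degree addEdge
  exact Multiset.countP_cons _ _ _

lemma degree_addVertex_castSucc (H : MHypergraph) (s : Multiset (Fin H.order))
    (v : Fin H.order) :
    (H.addVertex s).degree (Fin.castSucc v) = H.degree v + if v ∈ s then 1 else 0 := by
  unfold degree addVertex
  refine (Multiset.countP_cons _ _ _).trans ?_
  congr 1
  · rw [Multiset.countP_map, Multiset.countP_eq_card_filter]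
    congr 2
    ext e
    simp [Fin.castSucc_inj]
  · simp [Fin.castSucc_inj, (Fin.castSucc_lt_last v).ne]

lemma degree_addVertex_last (H : MHypergraph) (s : Multiset (Fin H.order)) :
    (H.addVertex s).degree (Fin.last H.order) = 1 := by
  unfold degree addVertex
  refine (Multiset.countP_cons _ _ _).trans ?_
  rw [Multiset.countP_map]
  simp [(Fin.castSucc_lt_last _).ne]

lemma sum_addVertex {α : Type*} [AddCommMonoid α] (H : MHypergraph) (s : Multiset (Fin H.order))
    (g : ℕ → α) :
    ∑ v, g ((H.addVertex s).degree v) =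
      ∑ v, g (H.degree v + if v ∈ s then 1 else 0) + g 1 := by
  have h := Fin.sum_univ_castSucc (fun v : Fin (H.order + 1) => g ((H.addVertex s).degree v))
  refine h.trans ?_
  congr 1
  · exact Finset.sum_congr rfl fun v _ => congrArg g (H.degree_addVertex_castSucc s v)
  · exact congrArg g (H.degree_addVertex_last s)

lemma sum_addEdge {α : Type*} [AddCommMonoid α] (H : MHypergraph) (s : Multiset (Fin H.order))
    (g : ℕ → α) :
    ∑ v, g ((H.addEdge s).degree v) = ∑ v, g (H.degree v + if v ∈ s then 1 else 0) :=
  Finset.sum_congr rfl fun v _ => congrArg g (H.degree_addEdge s v)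

lemma sum_mem_le_card {n : ℕ} (s : Multiset (Fin n)) :
    ∑ v, (if v ∈ s then 1 else 0) ≤ s.card := by
  rw [← Finset.card_filter]
  calc _ = s.toFinset.card := by congr 1; ext; simp
    _ ≤ _ := Multiset.toFinset_card_le s

lemma one_le_sum_mem {n : ℕ} (s : Multiset (Fin n)) (hs : s.card ≠ 0) :
    1 ≤ ∑ v, (if v ∈ s then 1 else 0) := by
  obtain ⟨v, hv⟩ := Multiset.exists_mem_of_ne_zero (s := s) (fun h => hs (by simp [h]))
  calc 1 = if v ∈ s then 1 else 0 := by simp [hv]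
    _ ≤ _ := Finset.single_le_sum (f := fun v => if v ∈ s then 1 else 0)
      (fun _ _ => Nat.zero_le _) (Finset.mem_univ v)

lemma totalDegree_addEdge (H : MHypergraph) (s : Multiset (Fin H.order)) :
    (H.addEdge s).totalDegree = H.totalDegree + ∑ v, if v ∈ s then 1 else 0 := by
  rw [totalDegree, H.sum_addEdge s fun d => d, Finset.sum_add_distrib, totalDegree]

lemma totalDegree_addVertex (H : MHypergraph) (s : Multiset (Fin H.order)) :
    (H.addVertex s).totalDegree = H.totalDegree + (∑ v, if v ∈ s then 1 else 0) + 1 := by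
  rw [totalDegree, H.sum_addVertex s fun d => d, Finset.sum_add_distrib, totalDegree]

/-! ### Numbers of vertices of large degree -/

/-- The number of vertices of degree larger than `n`. -/
def tailCount (n : ℕ) (H : MHypergraph) : ℝ := ∑ v, if n < H.degree v then 1 else 0

/-- The number of vertices of degree `n`, as a real number. -/
def levelCount (n : ℕ) (H : MHypergraph) : ℝ := ∑ v, if H.degree v = n then 1 else 0

lemma degreeCount_eq_levelCount (H : MHypergraph) (n : ℕ) :
    (H.degreeCount n : ℝ) = levelCount n H := by
  simp [degreeCount, levelCount]

lemma levelCount_succ (n : ℕ) (H : MHypergraph) :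
    levelCount (n + 1) H = tailCount n H - tailCount (n + 1) H := by
  rw [levelCount, tailCount, tailCount, ← Finset.sum_sub_distrib]
  refine Finset.sum_congr rfl fun v _ => ?_
  split_ifs <;> first | omega | norm_num

lemma tailCount_nonneg (n : ℕ) (H : MHypergraph) : 0 ≤ tailCount n H :=
  Finset.sum_nonneg fun v _ => by split_ifs <;> norm_num

lemma levelCount_nonneg (n : ℕ) (H : MHypergraph) : 0 ≤ levelCount n H :=
  Finset.sum_nonneg fun v _ => by split_ifs <;> norm_num

lemma tailCount_le_order (n : ℕ) (H : MHypergraph) : tailCount n H ≤ H.order := by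
  calc tailCount n H ≤ ∑ _v : Fin H.order, (1 : ℝ) :=
        Finset.sum_le_sum fun v _ => by split_ifs <;> norm_num
    _ = _ := by simp

lemma levelCount_le_order (n : ℕ) (H : MHypergraph) : levelCount n H ≤ H.order := by
  calc levelCount n H ≤ ∑ _v : Fin H.order, (1 : ℝ) :=
        Finset.sum_le_sum fun v _ => by split_ifs <;> norm_num
    _ = _ := by simp

lemma sum_tailCount_le_totalDegree (K : ℕ) (H : MHypergraph) :
    ∑ n ∈ Finset.range K, tailCount n H ≤ H.totalDegree := by
  simp only [tailCount]
  rw [Finset.sum_comm, totalDegree, Nat.cast_sum]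
  refine Finset.sum_le_sum fun v _ => ?_
  rw [← Nat.cast_one, ← Nat.cast_zero]
  simp only [← Nat.cast_ite]
  rw [← Nat.cast_sum, ← Finset.card_filter]
  refine Nat.cast_le.2 ?_
  calc _ ≤ (Finset.range (H.degree v)).card :=
        Finset.card_le_card fun n hn => by simp at hn ⊢; omega
    _ = _ := by simp

lemma tailCount_succ_addEdge (n : ℕ) (H : MHypergraph) (s : Multiset (Fin H.order)) :
    tailCount (n + 1) (H.addEdge s) = tailCount (n + 1) H +
      ∑ v, if H.degree v = n + 1 then (if v ∈ s then 1 else 0) else 0 := by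
  rw [tailCount, H.sum_addEdge s fun d => if n + 1 < d then (1 : ℝ) else 0, tailCount,
    ← Finset.sum_add_distrib]
  refine Finset.sum_congr rfl fun v _ => ?_
  split_ifs <;> first | omega | norm_num

lemma tailCount_succ_addVertex (n : ℕ) (H : MHypergraph) (s : Multiset (Fin H.order)) :
    tailCount (n + 1) (H.addVertex s) = tailCount (n + 1) H +
      ∑ v, if H.degree v = n + 1 then (if v ∈ s then 1 else 0) else 0 := by
  rw [tailCount, H.sum_addVertex s fun d => if n + 1 < d then (1 : ℝ) else 0, tailCount,
    ← Finset.sum_add_distrib, if_neg (by omega), add_zero]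
  refine Finset.sum_congr rfl fun v _ => ?_
  split_ifs <;> first | omega | norm_num

/-! ### Expectations as finite sums -/

/-- The probability that `v` is selected, as a real number. -/
def weight (H : MHypergraph) (v : Fin H.order) : ℝ := (H.selectVertex v).toReal

lemma weight_nonneg (H : MHypergraph) (v : Fin H.order) : 0 ≤ H.weight v := ENNReal.toReal_nonneg

lemma sum_weight (H : MHypergraph) : ∑ v, H.weight v = 1 := by
  unfold weight
  rw [← ENNReal.toReal_sum fun v _ => PMF.apply_ne_top _ v, ← tsum_fintype (L := .unconditional _),
    PMF.tsum_coe, ENNReal.toReal_one]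

lemma weight_eq (H : MHypergraph) (h : H.totalDegree ≠ 0) (v : Fin H.order) :
    H.weight v = H.degree v / H.totalDegree := by
  simp [weight, selectVertex, h]

/-- Expectation over `j` independently selected vertices. -/
def selectExp (H : MHypergraph) : ℕ → (Multiset (Fin H.order) → ℝ) →ₗ[ℝ] ℝ
  | 0 => LinearMap.proj 0
  | j + 1 => ∑ v, H.weight v • (H.selectExp j).comp (LinearMap.funLeft ℝ ℝ fun s => v ::ₘ s)

lemma selectExp_zero (H : MHypergraph) (g : Multiset (Fin H.order) → ℝ) :
    H.selectExp 0 g = g 0 := rfl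

lemma selectExp_succ (H : MHypergraph) (j : ℕ) (g : Multiset (Fin H.order) → ℝ) :
    H.selectExp (j + 1) g = ∑ v, H.weight v * H.selectExp j fun s => g (v ::ₘ s) := by
  simp only [selectExp, LinearMap.sum_apply, LinearMap.smul_apply, LinearMap.comp_apply,
    smul_eq_mul]
  rfl

/-- Expectation over the next hypergraph, if the arriving hyperedge has cardinality `y`. -/
def stepExp (p : ℝ) (y : ℕ) : (MHypergraph → ℝ) →ₗ[ℝ] (MHypergraph → ℝ) :=
  LinearMap.pi fun H =>
    p • (H.selectExp (y - 1)).comp (LinearMap.funLeft ℝ ℝ H.addVertex) +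
    (1 - p) • (H.selectExp y).comp (LinearMap.funLeft ℝ ℝ H.addEdge)

lemma stepExp_apply (p : ℝ) (y : ℕ) (f : MHypergraph → ℝ) (H : MHypergraph) :
    stepExp p y f H = p * H.selectExp (y - 1) (fun s => f (H.addVertex s)) +
      (1 - p) * H.selectExp y (fun s => f (H.addEdge s)) := rfl

/-- Expectation over the hypergraph at a given time. -/
def lawExp (p : ℝ) (y : ℕ → ℕ) : ℕ → (MHypergraph → ℝ) →ₗ[ℝ] ℝ
  | 0 => LinearMap.proj (initial (y 0))
  | t + 1 => (lawExp p y t).comp (stepExp p (y (t + 1)))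

lemma lawExp_zero (p : ℝ) (y : ℕ → ℕ) (f : MHypergraph → ℝ) :
    lawExp p y 0 f = f (initial (y 0)) := rfl

lemma lawExp_succ (p : ℝ) (y : ℕ → ℕ) (t : ℕ) (f : MHypergraph → ℝ) :
    lawExp p y (t + 1) f = lawExp p y t (stepExp p (y (t + 1)) f) := rfl

lemma lawExp_congr {p : ℝ} {y z : ℕ → ℕ} {t : ℕ} (h : ∀ i ≤ t, y i = z i) :
    lawExp p y t = lawExp p z t := by
  induction t with
  | zero => simp only [lawExp, h 0 le_rfl]
  | succ t ih => simp only [lawExp, h (t + 1) le_rfl, ih fun i hi => h i (by omega)]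

lemma selectExp_mono (H : MHypergraph) {j : ℕ} {g g' : Multiset (Fin H.order) → ℝ}
    (h : ∀ s, s.card = j → g s ≤ g' s) : H.selectExp j g ≤ H.selectExp j g' := by
  induction j generalizing g g' with
  | zero => exact h 0 rfl
  | succ j ih =>
    rw [selectExp_succ, selectExp_succ]
    refine Finset.sum_le_sum fun v _ => mul_le_mul_of_nonneg_left (ih fun s hs => ?_)
      (H.weight_nonneg v)
    exact h _ (by simp [hs])

lemma selectExp_const (H : MHypergraph) (j : ℕ) (c : ℝ) : H.selectExp j (fun _ => c) = c := by
  induction j with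
  | zero => rfl
  | succ j ih => simp only [selectExp_succ, ih, ← Finset.sum_mul, sum_weight, one_mul]

lemma selectExp_notMem (H : MHypergraph) (j : ℕ) (v : Fin H.order) :
    H.selectExp j (fun s => if v ∈ s then 0 else 1) = (1 - H.weight v) ^ j := by
  induction j with
  | zero => simp [selectExp_zero]
  | succ j ih =>
    have hterm : ∀ w, (H.selectExp j fun s => if v ∈ w ::ₘ s then (0 : ℝ) else 1) =
        (1 - if w = v then 1 else 0) * (1 - H.weight v) ^ j := by
      intro w
      by_cases hw : w = v
      · subst hw
        simpa using H.selectExp_const j 0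
      · simp [hw, Ne.symm hw, ih]
    rw [selectExp_succ]
    simp only [hterm]
    simp only [← mul_assoc, ← Finset.sum_mul, mul_sub, mul_one, Finset.sum_sub_distrib, sum_weight,
      mul_ite, mul_zero, Finset.sum_ite_eq', Finset.mem_univ, if_true]
    ring

lemma selectExp_mem (H : MHypergraph) (j : ℕ) (v : Fin H.order) :
    H.selectExp j (fun s => if v ∈ s then 1 else 0) = 1 - (1 - H.weight v) ^ j := by
  have : (fun s : Multiset (Fin H.order) => if v ∈ s then (1 : ℝ) else 0) =
      (fun _ => 1) - fun s => if v ∈ s then 0 else 1 := by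
    ext s
    by_cases h : v ∈ s <;> simp [h]
  rw [this, map_sub, selectExp_const, selectExp_notMem]

/-- The probability that a vertex of selection probability `x` belongs to an arriving hyperedge of
cardinality `y`. -/
def hitProb (p : ℝ) (y : ℕ) (x : ℝ) : ℝ :=
  p * (1 - (1 - x) ^ (y - 1)) + (1 - p) * (1 - (1 - x) ^ y)

lemma stepExp_tailCount_succ (p : ℝ) (y n : ℕ) (H : MHypergraph) (hH : H.totalDegree ≠ 0) :
    stepExp p y (tailCount (n + 1)) H = tailCount (n + 1) H +
      levelCount (n + 1) H * hitProb p y ((n + 1 : ℝ) / H.totalDegree) := by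
  have key : ∀ j, (H.selectExp j fun s => tailCount (n + 1) H +
      ∑ v, if H.degree v = n + 1 then (if v ∈ s then (1 : ℝ) else 0) else 0) =
      tailCount (n + 1) H +
        levelCount (n + 1) H * (1 - (1 - (n + 1 : ℝ) / H.totalDegree) ^ j) := by
    intro j
    have h1 : (fun s : Multiset (Fin H.order) => tailCount (n + 1) H +
        ∑ v, if H.degree v = n + 1 then (if v ∈ s then (1 : ℝ) else 0) else 0) =
        (fun _ => tailCount (n + 1) H) + ∑ v, (if H.degree v = n + 1 then (1 : ℝ) else 0) •
          fun s : Multiset (Fin H.order) => if v ∈ s then (1 : ℝ) else 0 := by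
      ext s
      simp only [Pi.add_apply, Finset.sum_apply, Pi.smul_apply, smul_eq_mul, ite_mul, one_mul,
        zero_mul]
    rw [h1, map_add, map_sum, selectExp_const, levelCount, Finset.sum_mul]
    congr 1
    refine Finset.sum_congr rfl fun v _ => ?_
    rw [map_smul, selectExp_mem, weight_eq H hH, smul_eq_mul]
    by_cases hv : H.degree v = n + 1
    · simp [hv]
    · simp [hv]
  rw [stepExp_apply]
  simp only [tailCount_succ_addEdge, tailCount_succ_addVertex]
  rw [key, key, hitProb]
  ring

/-! ### Invariants of the process -/

/-- Properties that the hypergraph at time `t` has almost surely. -/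
structure Reachable (y : ℕ → ℕ) (t : ℕ) (H : MHypergraph) : Prop where
  order_le : H.order ≤ t + 1
  lt_totalDegree : t < H.totalDegree
  totalDegree_le : H.totalDegree ≤ 1 + ∑ i ∈ Finset.range t, y (i + 1)
  degree_pos : ∀ v, 0 < H.degree v

lemma reachable_initial (y : ℕ → ℕ) (hy : 2 ≤ y 0) : Reachable y 0 (initial (y 0)) := by
  have hd : ∀ v : Fin (initial (y 0)).order, (initial (y 0)).degree v = 1 := by
    have h : ∀ v : Fin 1, (initial (y 0)).degree v = 1 := fun v =>
      Multiset.countP_cons_of_pos (p := fun e : Multiset (Fin 1) => v ∈ e) 0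
        (Multiset.mem_replicate.2 ⟨by omega, Subsingleton.elim _ _⟩)
    exact h
  have hD : (initial (y 0)).totalDegree = 1 := by
    simp only [totalDegree, hd]
    exact Fin.sum_univ_one fun _ => 1
  exact ⟨le_rfl, by omega, by simp [hD], fun v => by rw [hd]; norm_num⟩

lemma Reachable.addEdge {y : ℕ → ℕ} {t : ℕ} {H : MHypergraph} (h : Reachable y t H)
    (s : Multiset (Fin H.order)) (hs : s.card = y (t + 1)) (hy : 2 ≤ y (t + 1)) :
    Reachable y (t + 1) (H.addEdge s) := by
  have h1 := sum_mem_le_card s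
  have h2 := one_le_sum_mem s (by omega)
  have := h.lt_totalDegree
  have := h.totalDegree_le
  refine ⟨h.order_le.trans (by omega), ?_, ?_, fun v => ?_⟩
  · rw [totalDegree_addEdge]; omega
  · rw [totalDegree_addEdge, Finset.sum_range_succ]; omega
  · exact (Nat.add_pos_left (h.degree_pos v) _).trans_eq (H.degree_addEdge s v).symm

lemma Reachable.addVertex {y : ℕ → ℕ} {t : ℕ} {H : MHypergraph} (h : Reachable y t H)
    (s : Multiset (Fin H.order)) (hs : s.card = y (t + 1) - 1) (hy : 2 ≤ y (t + 1)) :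
    Reachable y (t + 1) (H.addVertex s) := by
  have h1 := sum_mem_le_card s
  have := h.lt_totalDegree
  have := h.totalDegree_le
  refine ⟨Nat.succ_le_succ h.order_le, ?_, ?_, fun v => ?_⟩
  · rw [totalDegree_addVertex]; omega
  · rw [totalDegree_addVertex, Finset.sum_range_succ]; omega
  · induction v using Fin.lastCases with
    | last => rw [degree_addVertex_last]; norm_num
    | cast v => rw [degree_addVertex_castSucc]; exact Nat.add_pos_left (h.degree_pos v) _

lemma lawExp_mono {p : ℝ} (hp0 : 0 ≤ p) (hp1 : p ≤ 1) {y : ℕ → ℕ} (hy : ∀ i, 2 ≤ y i) {t : ℕ}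
    {f g : MHypergraph → ℝ} (h : ∀ H, Reachable y t H → f H ≤ g H) :
    lawExp p y t f ≤ lawExp p y t g := by
  induction t generalizing f g with
  | zero => exact h _ (reachable_initial y (hy 0))
  | succ t ih =>
    rw [lawExp_succ, lawExp_succ]
    refine ih fun H hH => ?_
    rw [stepExp_apply, stepExp_apply]
    refine add_le_add (mul_le_mul_of_nonneg_left (H.selectExp_mono fun s hs => ?_) hp0)
      (mul_le_mul_of_nonneg_left (H.selectExp_mono fun s hs => ?_) (sub_nonneg.2 hp1))
    · exact h _ (hH.addVertex s hs (hy _))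
    · exact h _ (hH.addEdge s hs (hy _))

lemma lawExp_const (p : ℝ) (y : ℕ → ℕ) (t : ℕ) (c : ℝ) : lawExp p y t (fun _ => c) = c := by
  induction t with
  | zero => rfl
  | succ t ih =>
    rw [lawExp_succ]
    convert ih using 2
    ext H
    rw [stepExp_apply, selectExp_const, selectExp_const]
    ring

lemma lawExp_tailCount_zero {p : ℝ} (hp0 : 0 ≤ p) (hp1 : p ≤ 1) {y : ℕ → ℕ}
    (hy : ∀ i, 2 ≤ y i) (t : ℕ) : lawExp p y t (tailCount 0) = 1 + p * t := by
  have horder : ∀ t, lawExp p y t (fun H => (H.order : ℝ)) = 1 + p * t := by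
    intro t
    induction t with
    | zero => simp [lawExp_zero, initial]
    | succ t ih =>
      rw [lawExp_succ]
      have : stepExp p (y (t + 1)) (fun H => (H.order : ℝ)) =
          (fun H => (H.order : ℝ)) + fun _ => p := by
        ext H
        have h1 : ∀ s, ((H.addVertex s).order : ℝ) = H.order + 1 := fun s => by
          simp [MHypergraph.addVertex]
        have h2 : ∀ s, ((H.addEdge s).order : ℝ) = H.order := fun s => rfl
        rw [stepExp_apply]
        simp only [h1, h2, selectExp_const, Pi.add_apply]
        ring
      rw [this, map_add, ih, lawExp_const]
      push_cast
      ring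
  have heq : ∀ H, Reachable y t H → tailCount 0 H = H.order := fun H hH => by
    simp [tailCount, hH.degree_pos]
  rw [← horder t]
  exact le_antisymm (lawExp_mono hp0 hp1 hy fun H hH => (heq H hH).le)
    (lawExp_mono hp0 hp1 hy fun H hH => (heq H hH).ge)

/-! ### Comparison with the law of the process -/

lemma tsum_bind_mul {α β : Type*} (q : PMF α) (k : α → PMF β) (f : β → ℝ≥0∞) :
    ∑' b, q.bind k b * f b = ∑' a, q a * ∑' b, k a b * f b := by
  simp only [PMF.bind_apply, ← ENNReal.tsum_mul_right, ← ENNReal.tsum_mul_left]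
  rw [ENNReal.tsum_comm]
  simp only [mul_assoc]

lemma tsum_pure_mul {α : Type*} (a : α) (f : α → ℝ≥0∞) :
    ∑' b, PMF.pure a b * f b = f a := by
  classical
  rw [tsum_eq_single a]
  · simp
  · intro b hb
    simp [hb]

lemma tsum_map_mul {α β : Type*} (q : PMF α) (g : α → β) (f : β → ℝ≥0∞) :
    ∑' b, q.map g b * f b = ∑' a, q a * f (g a) := by
  simp only [PMF.map, tsum_bind_mul, Function.comp, tsum_pure_mul]

lemma selectExp_nonneg (H : MHypergraph) (j : ℕ) {g : Multiset (Fin H.order) → ℝ}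
    (hg : ∀ s, 0 ≤ g s) : 0 ≤ H.selectExp j g := by
  rw [← H.selectExp_const j 0]
  exact H.selectExp_mono fun s _ => hg s

lemma stepExp_nonneg {p : ℝ} (hp0 : 0 ≤ p) (hp1 : p ≤ 1) (y : ℕ) {f : MHypergraph → ℝ}
    (hf : ∀ H, 0 ≤ f H) (H : MHypergraph) : 0 ≤ stepExp p y f H := by
  rw [stepExp_apply]
  exact add_nonneg (mul_nonneg hp0 (H.selectExp_nonneg _ fun s => hf _))
    (mul_nonneg (sub_nonneg.2 hp1) (H.selectExp_nonneg _ fun s => hf _))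

lemma tsum_selectVertices_mul (H : MHypergraph) (j : ℕ) {g : Multiset (Fin H.order) → ℝ}
    (hg : ∀ s, 0 ≤ g s) :
    ∑' s, H.selectVertices j s * ENNReal.ofReal (g s) = ENNReal.ofReal (H.selectExp j g) := by
  induction j generalizing g with
  | zero => exact tsum_pure_mul _ _
  | succ j ih =>
    rw [selectVertices, tsum_bind_mul, selectExp_succ, ENNReal.ofReal_sum_of_nonneg
      fun v _ => mul_nonneg (H.weight_nonneg v) (H.selectExp_nonneg j fun s => hg _),
      tsum_fintype]
    refine Finset.sum_congr rfl fun v _ => ?_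
    rw [tsum_map_mul, ih fun s => hg _, ENNReal.ofReal_mul (H.weight_nonneg v), weight,
      ENNReal.ofReal_toReal (PMF.apply_ne_top _ _)]

lemma tsum_step_mul (p : ℝ≥0) (hp : p ≤ 1) (y : ℕ) (H : MHypergraph) {f : MHypergraph → ℝ}
    (hf : ∀ H, 0 ≤ f H) :
    ∑' H', step p hp y H H' * ENNReal.ofReal (f H') = ENNReal.ofReal (stepExp p y f H) := by
  have hp1 : (p : ℝ) ≤ 1 := by exact_mod_cast hp
  rw [step, tsum_bind_mul, tsum_fintype, Fintype.sum_bool]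
  simp only [if_true, Bool.false_eq_true, if_false]
  rw [tsum_map_mul, tsum_map_mul, tsum_selectVertices_mul H _ fun s => hf _,
    tsum_selectVertices_mul H _ fun s => hf _, stepExp_apply,
    ENNReal.ofReal_add (mul_nonneg p.coe_nonneg (H.selectExp_nonneg _ fun s => hf _))
      (mul_nonneg (sub_nonneg.2 hp1) (H.selectExp_nonneg _ fun s => hf _)),
    ENNReal.ofReal_mul p.coe_nonneg, ENNReal.ofReal_mul (sub_nonneg.2 hp1)]
  congr 2
  simp [arrivalBit]

lemma tsum_lawAt_mul (p : ℝ≥0) (hp : p ≤ 1) (y : ℕ → ℕ) (t : ℕ) {f : MHypergraph → ℝ}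
    (hf : ∀ H, 0 ≤ f H) :
    ∑' H, lawAt p hp y t H * ENNReal.ofReal (f H) = ENNReal.ofReal (lawExp p y t f) := by
  induction t generalizing f with
  | zero => exact tsum_pure_mul _ _
  | succ t ih =>
    rw [lawAt, tsum_bind_mul, lawExp_succ,
      ← ih (stepExp_nonneg p.coe_nonneg (by exact_mod_cast hp) _ hf)]
    simp only [tsum_step_mul p hp _ _ hf]

end MHypergraph

/-! ### A recursion for sequences of linear growth -/

/-- `a t / t` is asymptotically at least `A`. -/
def GrowsAtLeast (a : ℕ → ℝ) (A : ℝ) : Prop := ∀ ε > 0, ∀ᶠ t : ℕ in atTop, (A - ε) * t ≤ a t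

lemma GrowsAtLeast.of_recursion {a b e : ℕ → ℝ} {c B : ℝ} (hc : 0 ≤ c) (hb : GrowsAtLeast b B)
    (he : Tendsto e atTop (𝓝 0))
    (h : ∀ᶠ t : ℕ in atTop, a t + c * (b t - a t) / t - e t ≤ a (t + 1)) :
    GrowsAtLeast a (c * B / (1 + c)) := by
  intro ε hε
  set A := c * B / (1 + c) with hA
  have hAB : c * B = A * (1 + c) := by rw [hA]; field_simp
  set δ := ε / 2 with hδ
  have hδ0 : 0 < δ := by positivity
  have hη : 0 < δ / (2 * (c + 1)) := by positivity
  obtain ⟨t₀, ht₀⟩ := eventually_atTop.1 ((((hb _ hη).and (he.eventually_lt_const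
    (half_pos hδ0))).and h).and (eventually_ge_atTop (⌈c⌉₊ + 1)))
  set C := max 0 (A * t₀ - a t₀) with hC
  have hC0 : 0 ≤ C := le_max_left _ _
  have key : ∀ t ≥ t₀, (A - δ) * t - C ≤ a t := by
    intro t ht
    induction t, ht using Nat.le_induction with
    | base =>
      have : A * t₀ - a t₀ ≤ C := le_max_right _ _
      have : (0 : ℝ) ≤ δ * t₀ := by positivity
      linarith
    | succ t ht ih =>
      obtain ⟨⟨⟨h1, h2⟩, h3⟩, h4⟩ := ht₀ t ht
      have htpos : (0 : ℝ) < t := by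
        have : 0 < t := by omega
        exact_mod_cast this
      have hct : c ≤ t := (Nat.le_ceil c).trans (by exact_mod_cast (by omega : ⌈c⌉₊ ≤ t))
      have hct' : c / t ≤ 1 := (div_le_one htpos).2 hct
      have hct0 : 0 ≤ c / t := by positivity
      have hbt : c * B - δ / 2 ≤ c * b t / t := by
        rw [le_div_iff₀ htpos]
        have h5 : c * ((B - δ / (2 * (c + 1))) * t) ≤ c * b t := mul_le_mul_of_nonneg_left h1 hc
        have h6 : c * (δ / (2 * (c + 1))) ≤ δ / 2 := by
          rw [mul_div_assoc', div_le_div_iff₀ (by positivity) (by positivity)]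
          nlinarith
        nlinarith [mul_le_mul_of_nonneg_right h6 htpos.le]
      have hsplit : c * (b t - a t) / t = c * b t / t - c / t * a t := by ring
      have h7 : (1 - c / t) * ((A - δ) * t - C) ≤ (1 - c / t) * a t :=
        mul_le_mul_of_nonneg_left ih (by linarith)
      have h8 : c / t * ((A - δ) * t - C) = c * (A - δ) - c / t * C := by
        field_simp
      have h9 : 0 ≤ c / t * C := by positivity
      have h10 : 0 ≤ c * δ := by positivity
      push_cast
      nlinarith
  filter_upwards [eventually_ge_atTop t₀, eventually_ge_atTop ⌈C / δ⌉₊] with t h1 h2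
  have h3 : C / δ ≤ t := (Nat.le_ceil _).trans (by exact_mod_cast h2)
  rw [div_le_iff₀ hδ0] at h3
  have := key t h1
  nlinarith

lemma tendsto_div_of_growsAtLeast {a : ℕ → ℝ} {A : ℝ} (h1 : GrowsAtLeast a A)
    (h2 : GrowsAtLeast (fun t => -a t) (-A)) : Tendsto (fun t : ℕ => a t / t) atTop (𝓝 A) := by
  rw [Metric.tendsto_nhds]
  intro ε hε
  filter_upwards [h1 (ε / 2) (half_pos hε), h2 (ε / 2) (half_pos hε), eventually_gt_atTop 0]
    with t h3 h4 ht
  have ht' : (0 : ℝ) < t := by exact_mod_cast ht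
  rw [Real.dist_eq, abs_lt]
  constructor
  · rw [lt_sub_iff_add_lt, lt_div_iff₀ ht']
    nlinarith
  · rw [sub_lt_iff_lt_add, div_lt_iff₀ ht']
    nlinarith

/-! ### The limiting degree distribution -/

/-- The asymptotic proportion of vertices of degree larger than `n`, relative to time. -/
def tailLimit (p b : ℝ) (n : ℕ) : ℝ := p * ∏ j ∈ Finset.range n, ((j + 1 : ℝ) / (j + 1 + b))

lemma tailLimit_zero (p b : ℝ) : tailLimit p b 0 = p := by simp [tailLimit]

lemma tailLimit_succ (p b : ℝ) (n : ℕ) :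
    tailLimit p b (n + 1) = tailLimit p b n * ((n + 1 : ℝ) / (n + 1 + b)) := by
  rw [tailLimit, Finset.prod_range_succ, tailLimit, mul_assoc]

lemma tailLimit_eq_gammaSeq {p b : ℝ} (hb : 0 < b) {n : ℕ} (hn : 0 < n) :
    tailLimit p b n = p * b * Real.GammaSeq b n * (n : ℝ) ^ (-b) := by
  have hn' : (0 : ℝ) < n := by exact_mod_cast hn
  have h1 : ∏ j ∈ Finset.range n, ((j + 1 : ℝ) / (j + 1 + b)) =
      n.factorial / ∏ j ∈ Finset.range n, (j + 1 + b : ℝ) := by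
    rw [Finset.prod_div_distrib, ← Finset.prod_range_add_one_eq_factorial]
    push_cast
    rfl
  have h2 : ∏ j ∈ Finset.range (n + 1), (b + j : ℝ) =
      b * ∏ j ∈ Finset.range n, (j + 1 + b : ℝ) := by
    rw [Finset.prod_range_succ', mul_comm]
    congr 1
    · simp
    · exact Finset.prod_congr rfl fun j _ => by push_cast; ring
  have h3 : ∏ j ∈ Finset.range n, (j + 1 + b : ℝ) ≠ 0 :=
    Finset.prod_ne_zero_iff.2 fun j _ => by positivity
  have h4 : (n : ℝ) ^ b ≠ 0 := (Real.rpow_pos_of_pos hn' b).ne'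
  rw [tailLimit, h1, Real.GammaSeq, h2, Real.rpow_neg hn'.le]
  field_simp

lemma tendsto_mul_tailLimit {p b : ℝ} (hb : 1 < b) :
    Tendsto (fun n : ℕ => (n : ℝ) * tailLimit p b n) atTop (𝓝 0) := by
  have h1 : Tendsto (fun n : ℕ => (n : ℝ) ^ (-(b - 1))) atTop (𝓝 0) :=
    (tendsto_rpow_neg_atTop (by linarith)).comp tendsto_natCast_atTop_atTop
  have h2 := ((Real.GammaSeq_tendsto_Gamma b).const_mul (p * b)).mul h1
  rw [mul_zero] at h2
  refine h2.congr' ?_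
  filter_upwards [eventually_gt_atTop 0] with n hn
  have hn' : (0 : ℝ) < n := by exact_mod_cast hn
  rw [tailLimit_eq_gammaSeq (by linarith) hn, neg_sub, sub_eq_add_neg, Real.rpow_add hn',
    Real.rpow_one]
  ring

lemma tendsto_sum_tailLimit {p b : ℝ} (hb : 1 < b) :
    Tendsto (fun K : ℕ => ∑ n ∈ Finset.range K, tailLimit p b n) atTop
      (𝓝 (p * b / (b - 1))) := by
  have h0 : b - 1 ≠ 0 := by linarith
  have h1 : ∀ K : ℕ, ∑ n ∈ Finset.range K, tailLimit p b n =
      (p * b - (K + b) * tailLimit p b K) / (b - 1) := by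
    intro K
    induction K with
    | zero => simp [tailLimit_zero, mul_comm p b]
    | succ K ih =>
      have : (K + 1 + b : ℝ) ≠ 0 := by positivity
      rw [Finset.sum_range_succ, ih, tailLimit_succ]
      push_cast
      field_simp
      ring
  have h2 : Tendsto (fun n : ℕ => tailLimit p b n) atTop (𝓝 0) := by
    have := (tendsto_mul_tailLimit (p := p) hb).mul (tendsto_inv_atTop_nhds_zero_nat (𝕜 := ℝ))
    rw [mul_zero] at this
    refine this.congr' ?_
    filter_upwards [eventually_gt_atTop 0] with n hn
    have hn' : (0 : ℝ) < n := by exact_mod_cast hn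
    field_simp
  simp only [h1]
  have h3 := (((tendsto_mul_tailLimit (p := p) hb).add (h2.const_mul b)).const_sub
    (p * b)).div_const (b - 1)
  simpa [add_mul] using h3

lemma tailLimit_sub_succ {p b : ℝ} (hb : 0 < b) (n : ℕ) :
    tailLimit p b n - tailLimit p b (n + 1) = tailLimit p b n * (b / (n + 1 + b)) := by
  have : (n + 1 + b : ℝ) ≠ 0 := by positivity
  rw [tailLimit_succ]
  field_simp
  ring

lemma followsPowerLaw_tailLimit {p b : ℝ} (hp : 0 < p) (hb : 0 < b) :
    FollowsPowerLaw (fun k => tailLimit p b (k - 1) - tailLimit p b k) (1 + b) := by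
  refine ⟨p * b * Real.Gamma b * b, by have := Real.Gamma_pos_of_pos hb; positivity, ?_⟩
  have hΓ := Real.Gamma_pos_of_pos hb
  refine (isEquivalent_iff_tendsto_one ?_).2 ?_
  · filter_upwards [eventually_gt_atTop 0] with k hk
    have hk' : (0 : ℝ) < k := by exact_mod_cast hk
    positivity
  have h1 := (Real.GammaSeq_tendsto_Gamma b).div_const (Real.Gamma b)
  rw [div_self hΓ.ne'] at h1
  refine h1.congr' ?_
  filter_upwards [eventually_gt_atTop 0] with k hk
  have hk' : (0 : ℝ) < k := by exact_mod_cast hk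
  obtain ⟨n, rfl⟩ : ∃ n, k = n + 1 := ⟨k - 1, by omega⟩
  have h2 : tailLimit p b n - tailLimit p b (n + 1) =
      tailLimit p b (n + 1) * (b / (n + 1 : ℝ)) := by
    rw [tailLimit_sub_succ hb, tailLimit_succ]
    have : (n + 1 + b : ℝ) ≠ 0 := by positivity
    field_simp
  have h3 : ((n + 1 : ℕ) : ℝ) ^ (-b) ≠ 0 := (Real.rpow_pos_of_pos hk' _).ne'
  simp only [Pi.div_apply, Nat.add_sub_cancel]
  rw [h2, tailLimit_eq_gammaSeq hb hk, neg_add, Real.rpow_add hk', Real.rpow_neg_one]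
  push_cast at h3 ⊢
  have hΓ' := hΓ.ne'
  field_simp

/-! ### Bounds for the probability that a given vertex is hit -/

lemma one_sub_pow_le {x : ℝ} (hx0 : 0 ≤ x) (hx1 : x ≤ 1) (n : ℕ) :
    (1 - x) ^ n ≤ 1 - n * x + n ^ 2 * x ^ 2 := by
  induction n with
  | zero => simp
  | succ n ih =>
    have h := mul_le_mul_of_nonneg_right ih (sub_nonneg.2 hx1)
    rw [pow_succ]
    push_cast
    have h1 : (0 : ℝ) ≤ n ^ 2 * x ^ 3 := by positivity
    have h2 : (0 : ℝ) ≤ n * x ^ 2 := by positivity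
    nlinarith [sq_nonneg x]

namespace MHypergraph

lemma hitProb_le {p x : ℝ} (hp0 : 0 ≤ p) (hp1 : p ≤ 1) (hx1 : x ≤ 1) {y : ℕ}
    (hy : 2 ≤ y) : hitProb p y x ≤ (y - p) * x := by
  have h : ∀ n : ℕ, 1 - (1 - x) ^ n ≤ n * x := fun n => by
    have := one_add_mul_le_pow (a := -x) (by linarith) n
    rw [← sub_eq_add_neg] at this
    linarith
  have h1 := mul_le_mul_of_nonneg_left (h (y - 1)) hp0
  have h2 := mul_le_mul_of_nonneg_left (h y) (sub_nonneg.2 hp1)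
  rw [Nat.cast_sub (by omega), Nat.cast_one] at h1
  rw [hitProb]
  linarith

lemma le_hitProb {p x : ℝ} (hp0 : 0 ≤ p) (hp1 : p ≤ 1) (hx0 : 0 ≤ x) (hx1 : x ≤ 1) {y : ℕ}
    (hy : 2 ≤ y) : (y - p) * x - y ^ 2 * x ^ 2 ≤ hitProb p y x := by
  have h1 := mul_le_mul_of_nonneg_left (one_sub_pow_le hx0 hx1 (y - 1)) hp0
  have h2 := mul_le_mul_of_nonneg_left (one_sub_pow_le hx0 hx1 y) (sub_nonneg.2 hp1)
  rw [Nat.cast_sub (by omega), Nat.cast_one] at h1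
  have hy' : (2 : ℝ) ≤ y := by exact_mod_cast hy
  have h3 : p * ((y - 1 : ℝ) ^ 2 * x ^ 2) ≤ p * (y ^ 2 * x ^ 2) := by
    gcongr <;> linarith
  rw [hitProb]
  linarith

end MHypergraph

namespace MHypergraph

/-! ### Estimates for given hyperedge cardinalities -/

/-- An upper bound for the sum of the degrees at time `t`. -/
def degreeBound (y : ℕ → ℕ) (t : ℕ) : ℝ := 1 + ∑ i ∈ Finset.range t, (y (i + 1) : ℝ)

/-- The ratio of the number of vertices of degree `n + 1` and the sum of all degrees. -/
def levelRatio (n : ℕ) (H : MHypergraph) : ℝ := levelCount (n + 1) H / H.totalDegree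

lemma levelRatio_nonneg (n : ℕ) (H : MHypergraph) : 0 ≤ levelRatio n H :=
  div_nonneg (levelCount_nonneg _ H) (Nat.cast_nonneg _)

section Deterministic

variable {p : ℝ} (hp0 : 0 ≤ p) (hp1 : p ≤ 1) {y : ℕ → ℕ} (hy : ∀ i, 2 ≤ y i)

lemma Reachable.cast_lt_totalDegree {t : ℕ} {H : MHypergraph} (h : Reachable y t H) :
    (t + 1 : ℝ) ≤ H.totalDegree := by exact_mod_cast h.lt_totalDegree

lemma Reachable.totalDegree_le_degreeBound {t : ℕ} {H : MHypergraph} (h : Reachable y t H) :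
    (H.totalDegree : ℝ) ≤ degreeBound y t := by
  unfold degreeBound
  exact_mod_cast h.totalDegree_le

lemma Reachable.levelCount_le {t : ℕ} {H : MHypergraph} (h : Reachable y t H) (n : ℕ) :
    levelCount n H ≤ t + 1 :=
  (levelCount_le_order n H).trans (by exact_mod_cast h.order_le)

lemma Reachable.tailCount_le {t : ℕ} {H : MHypergraph} (h : Reachable y t H) (n : ℕ) :
    tailCount n H ≤ t + 1 :=
  (tailCount_le_order n H).trans (by exact_mod_cast h.order_le)

lemma Reachable.levelRatio_le_one {t : ℕ} {H : MHypergraph} (h : Reachable y t H) (n : ℕ) :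
    levelRatio n H ≤ 1 := by
  have h1 := h.cast_lt_totalDegree
  exact (div_le_one (by linarith [(Nat.cast_nonneg t : (0 : ℝ) ≤ t)])).2
    ((h.levelCount_le _).trans h1)

include hp0 hp1 hy

lemma abs_lawExp_le {t : ℕ} {f : MHypergraph → ℝ} {C : ℝ}
    (h : ∀ H, Reachable y t H → |f H| ≤ C) : |lawExp p y t f| ≤ C := by
  have h1 := lawExp_mono hp0 hp1 hy fun H hH => (abs_le.1 (h H hH)).1
  have h2 := lawExp_mono hp0 hp1 hy fun H hH => (abs_le.1 (h H hH)).2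
  rw [lawExp_const] at h1 h2
  exact abs_le.2 ⟨h1, h2⟩

lemma abs_lawExp_tailCount_le (n t : ℕ) : |lawExp p y t (tailCount n)| ≤ t + 1 :=
  abs_lawExp_le hp0 hp1 hy fun H hH => by
    rw [abs_of_nonneg (tailCount_nonneg n H)]
    exact hH.tailCount_le n

lemma abs_lawExp_levelCount_le (n t : ℕ) : |lawExp p y t (levelCount n)| ≤ t + 1 :=
  abs_lawExp_le hp0 hp1 hy fun H hH => by
    rw [abs_of_nonneg (levelCount_nonneg n H)]
    exact hH.levelCount_le n

lemma abs_lawExp_levelRatio_le (n t : ℕ) : |lawExp p y t (levelRatio n)| ≤ 1 :=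
  abs_lawExp_le hp0 hp1 hy fun H hH => by
    rw [abs_of_nonneg (levelRatio_nonneg n H)]
    exact hH.levelRatio_le_one n

lemma lawExp_totalDegree_nonneg (t : ℕ) : 0 ≤ lawExp p y t (fun H => (H.totalDegree : ℝ)) := by
  rw [← lawExp_const p y t 0]
  exact lawExp_mono hp0 hp1 hy fun H _ => Nat.cast_nonneg _

lemma lawExp_totalDegree_le (t : ℕ) :
    lawExp p y t (fun H => (H.totalDegree : ℝ)) ≤ degreeBound y t := by
  rw [← lawExp_const p y t (degreeBound y t)]
  exact lawExp_mono hp0 hp1 hy fun H hH => hH.totalDegree_le_degreeBound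

lemma sum_lawExp_tailCount_le (K t : ℕ) :
    ∑ n ∈ Finset.range K, lawExp p y t (tailCount n) ≤
      lawExp p y t (fun H => (H.totalDegree : ℝ)) := by
  rw [← map_sum]
  refine lawExp_mono hp0 hp1 hy fun H _ => ?_
  rw [Finset.sum_apply]
  exact sum_tailCount_le_totalDegree K H

lemma abs_lawExp_tailCount_increment_le {n t : ℕ} (hnt : n ≤ t) :
    |lawExp p y (t + 1) (tailCount (n + 1)) - lawExp p y t (tailCount (n + 1)) -
      (y (t + 1) - p) * ((n + 1) * lawExp p y t (levelRatio n))| ≤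
      (y (t + 1) : ℝ) ^ 2 * ((n + 1) ^ 2 / (t + 1)) := by
  have h1 : lawExp p y (t + 1) (tailCount (n + 1)) - lawExp p y t (tailCount (n + 1)) -
      (y (t + 1) - p) * ((n + 1) * lawExp p y t (levelRatio n)) =
      lawExp p y t (stepExp p (y (t + 1)) (tailCount (n + 1)) - tailCount (n + 1) -
        ((y (t + 1) - p) * (n + 1)) • levelRatio n) := by
    rw [map_sub, map_sub, map_smul, lawExp_succ, smul_eq_mul, mul_assoc]
  rw [h1]
  refine abs_lawExp_le hp0 hp1 hy fun H hH => ?_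
  have hD := hH.cast_lt_totalDegree
  have hnt' : (n : ℝ) ≤ t := by exact_mod_cast hnt
  have hDpos : (0 : ℝ) < H.totalDegree := by linarith [(Nat.cast_nonneg n : (0 : ℝ) ≤ n)]
  have hN := levelCount_nonneg (n + 1) H
  simp only [Pi.sub_apply, Pi.smul_apply, smul_eq_mul]
  rw [stepExp_tailCount_succ p _ n H (by exact_mod_cast hDpos.ne')]
  set x := (n + 1 : ℝ) / H.totalDegree with hx
  have hx0 : 0 ≤ x := by positivity
  have hx1 : x ≤ 1 := (div_le_one hDpos).2 (by linarith)
  have hup := mul_le_mul_of_nonneg_left (hitProb_le hp0 hp1 hx1 (hy (t + 1))) hN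
  have hlo := mul_le_mul_of_nonneg_left (le_hitProb hp0 hp1 hx0 hx1 (hy (t + 1))) hN
  have hrat : (y (t + 1) - p) * (n + 1) * levelRatio n H =
      levelCount (n + 1) H * ((y (t + 1) - p) * x) := by
    rw [levelRatio, hx]
    ring
  have herr : levelCount (n + 1) H * (y (t + 1) ^ 2 * x ^ 2) ≤
      (y (t + 1) : ℝ) ^ 2 * ((n + 1) ^ 2 / (t + 1)) := by
    have h2 : levelCount (n + 1) H * x ^ 2 ≤ (n + 1) ^ 2 / (t + 1) := by
      have h3 := hH.levelCount_le (n + 1)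
      rw [hx, div_pow, ← mul_div_assoc, div_le_div_iff₀ (by positivity) (by positivity)]
      have h4 : levelCount (n + 1) H * (t + 1) ≤ (H.totalDegree : ℝ) * H.totalDegree := by
        gcongr
        linarith
      nlinarith [mul_le_mul_of_nonneg_left h4 (sq_nonneg (n + 1 : ℝ))]
    nlinarith [mul_le_mul_of_nonneg_left h2 (sq_nonneg (y (t + 1) : ℝ))]
  have herr0 : 0 ≤ (y (t + 1) : ℝ) ^ 2 * ((n + 1) ^ 2 / (t + 1)) := by positivity
  rw [hrat, abs_le]
  constructor <;> linarith

lemma le_lawExp_levelRatio {μ : ℝ} (hμ : 0 < μ) {t : ℕ} (ht : 0 < t) (n : ℕ) :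
    (lawExp p y t (tailCount n) - lawExp p y t (tailCount (n + 1))) / (μ * t) -
      |degreeBound y t - μ * t| / (μ * t) ≤ lawExp p y t (levelRatio n) := by
  have ht' : (0 : ℝ) < t := by exact_mod_cast ht
  set E := |degreeBound y t - μ * t| / (μ * t) with hE
  have h1 : (lawExp p y t (tailCount n) - lawExp p y t (tailCount (n + 1))) / (μ * t) - E =
      lawExp p y t ((μ * t)⁻¹ • (tailCount n - tailCount (n + 1)) - fun _ => E) := by
    rw [map_sub, map_smul, map_sub, lawExp_const, smul_eq_mul]
    ring
  rw [h1]
  refine lawExp_mono hp0 hp1 hy fun H hH => ?_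
  have hD := hH.cast_lt_totalDegree
  have hS := hH.totalDegree_le_degreeBound
  have hN := levelCount_nonneg (n + 1) H
  have hNt := hH.levelCount_le (n + 1)
  simp only [Pi.sub_apply, Pi.smul_apply, smul_eq_mul]
  rw [← levelCount_succ, levelRatio]
  set S := degreeBound y t
  set N := levelCount (n + 1) H
  have hS0 : 0 < S := by linarith
  have h2 : N / S ≤ N / H.totalDegree := div_le_div_of_nonneg_left hN (by linarith) hS
  have h3 : (μ * t)⁻¹ * N - N / S = N / S * ((S - μ * t) / (μ * t)) := by
    field_simp
  have h4 : N / S ≤ 1 := (div_le_one hS0).2 (by linarith)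
  have h5 : N / S * ((S - μ * t) / (μ * t)) ≤ E := by
    calc N / S * ((S - μ * t) / (μ * t)) ≤ N / S * E := by
          rw [hE]; gcongr; exact le_abs_self _
      _ ≤ 1 * E := mul_le_mul_of_nonneg_right h4 (by positivity)
      _ = E := one_mul _
  linarith

lemma lawExp_levelRatio_le {μ : ℝ} (hμ : 0 < μ) {t : ℕ} (ht : 0 < t) (n : ℕ) :
    lawExp p y t (levelRatio n) ≤
      (lawExp p y t (tailCount n) - lawExp p y t (tailCount (n + 1))) / (μ * t) +
      |degreeBound y t - μ * t| / (μ * t) +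
      (degreeBound y t - lawExp p y t (fun H => (H.totalDegree : ℝ))) / (t + 1) := by
  have ht' : (0 : ℝ) < t := by exact_mod_cast ht
  set E := |degreeBound y t - μ * t| / (μ * t) with hE
  have h1 : (lawExp p y t (tailCount n) - lawExp p y t (tailCount (n + 1))) / (μ * t) + E +
      (degreeBound y t - lawExp p y t (fun H => (H.totalDegree : ℝ))) / (t + 1) =
      lawExp p y t ((μ * t)⁻¹ • (tailCount n - tailCount (n + 1)) + (fun _ => E) +
        (t + 1 : ℝ)⁻¹ • ((fun _ => degreeBound y t) - fun H => (H.totalDegree : ℝ))) := by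
    rw [map_add, map_add, map_smul, map_smul, map_sub, map_sub, lawExp_const, lawExp_const,
      smul_eq_mul, smul_eq_mul]
    ring
  rw [h1]
  refine lawExp_mono hp0 hp1 hy fun H hH => ?_
  have hD := hH.cast_lt_totalDegree
  have hS := hH.totalDegree_le_degreeBound
  have hN := levelCount_nonneg (n + 1) H
  have hNt := hH.levelCount_le (n + 1)
  simp only [Pi.sub_apply, Pi.add_apply, Pi.smul_apply, smul_eq_mul]
  rw [← levelCount_succ, levelRatio]
  set S := degreeBound y t
  set N := levelCount (n + 1) H
  set D := (H.totalDegree : ℝ)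
  have hD0 : 0 < D := by linarith
  have hS0 : 0 < S := by linarith
  have h4 : N / S ≤ 1 := (div_le_one hS0).2 (by linarith)
  have h4' : N / D ≤ 1 := (div_le_one hD0).2 (by linarith)
  have h2 : N / D - N / S ≤ (t + 1 : ℝ)⁻¹ * (S - D) := by
    calc N / D - N / S = N / D * (S⁻¹ * (S - D)) := by field_simp
      _ ≤ 1 * (S⁻¹ * (S - D)) := by
          refine mul_le_mul_of_nonneg_right h4' (mul_nonneg (by positivity) (by linarith))
      _ ≤ (t + 1 : ℝ)⁻¹ * (S - D) := by
          rw [one_mul]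
          refine mul_le_mul_of_nonneg_right (inv_anti₀ (by positivity) (by linarith)) (by linarith)
  have h3 : N / S - (μ * t)⁻¹ * N = N / S * (-(S - μ * t) / (μ * t)) := by
    field_simp
    ring
  have h5 : N / S * (-(S - μ * t) / (μ * t)) ≤ E := by
    calc N / S * (-(S - μ * t) / (μ * t)) ≤ N / S * E := by
          rw [hE]; gcongr; exact neg_le_abs _
      _ ≤ 1 * E := mul_le_mul_of_nonneg_right h4 (by positivity)
      _ = E := one_mul _
  linarith

end Deterministic

/-! ### Random hyperedge cardinalities -/

lemma exists_lawExp_eq_comp {Ω : Type*} (p : ℝ) (Y : ℕ → Ω → ℕ) (t : ℕ) (f : MHypergraph → ℝ) :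
    ∃ φ : (Finset.range (t + 1) → ℕ) → ℝ,
      (fun ω => lawExp p (fun i => Y i ω) t f) = φ ∘ fun ω (i : Finset.range (t + 1)) => Y i ω := by
  refine ⟨fun z => lawExp p (fun i => if h : i ∈ Finset.range (t + 1) then z ⟨i, h⟩ else 0) t f,
    funext fun ω => ?_⟩
  simp only [Function.comp]
  rw [lawExp_congr fun i hi => ?_]
  rw [dif_pos (by simp; omega)]

section Random

variable {Ω : Type*} [MeasurableSpace Ω] {P : Measure Ω} {Y : ℕ → Ω → ℕ}

lemma measurable_lawExp (hYmeas : ∀ t, Measurable (Y t)) (p : ℝ) (t : ℕ) (f : MHypergraph → ℝ) :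
    Measurable fun ω => lawExp p (fun i => Y i ω) t f := by
  obtain ⟨φ, hφ⟩ := exists_lawExp_eq_comp p Y t f
  rw [hφ]
  exact (measurable_of_countable φ).comp (measurable_pi_lambda _ fun i => hYmeas i)

lemma indepFun_lawExp (hYmeas : ∀ t, Measurable (Y t)) (hYindep : iIndepFun Y P) (p : ℝ) (t : ℕ)
    (f : MHypergraph → ℝ) (g : ℕ → ℝ) :
    IndepFun (fun ω => lawExp p (fun i => Y i ω) t f) (fun ω => g (Y (t + 1) ω)) P := by
  obtain ⟨φ, hφ⟩ := exists_lawExp_eq_comp p Y t f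
  rw [hφ]
  have h := hYindep.indepFun_finset (Finset.range (t + 1)) {t + 1} (by simp) hYmeas
  exact h.comp (measurable_of_countable φ)
    (measurable_of_countable fun z : (({t + 1} : Finset ℕ) → ℕ) => g (z ⟨t + 1, by simp⟩))

variable [IsProbabilityMeasure P]

lemma integrable_degreeBound {Y : ℕ → Ω → ℕ}
    (hYint : ∀ t, 1 ≤ t → Integrable (fun ω => (Y t ω : ℝ)) P) (t : ℕ) :
    Integrable (fun ω => degreeBound (fun i => Y i ω) t) P :=
  (integrable_const _).add (integrable_finsetSum _ fun i _ => hYint (i + 1) (by omega))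

lemma integral_degreeBound {Y : ℕ → Ω → ℕ} {μ : ℝ}
    (hYint : ∀ t, 1 ≤ t → Integrable (fun ω => (Y t ω : ℝ)) P)
    (hYmean : ∀ t, 1 ≤ t → ∫ ω, (Y t ω : ℝ) ∂P = μ) (t : ℕ) :
    ∫ ω, degreeBound (fun i => Y i ω) t ∂P = 1 + μ * t := by
  unfold degreeBound
  rw [integral_add (integrable_const _)
      (integrable_finsetSum _ fun i _ => hYint (i + 1) (by omega)),
    integral_finsetSum _ fun i _ => hYint (i + 1) (by omega)]
  simp only [hYmean _ (Nat.succ_pos _)]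
  simp [mul_comm]

lemma integrable_sq_of_le {X : Ω → ℕ} (hX : Measurable X) {C : ℝ}
    (h : ∀ᵐ ω ∂P, (X ω : ℝ) ≤ C) : Integrable (fun ω => (X ω : ℝ) ^ 2) P := by
  refine Integrable.of_bound (C := C ^ 2)
    ((measurable_of_countable (fun n : ℕ => (n : ℝ) ^ 2)).comp hX).aestronglyMeasurable ?_
  filter_upwards [h] with ω hω
  rw [Real.norm_of_nonneg (by positivity)]
  gcongr

lemma integral_sq_le {X : Ω → ℕ} (hX : Measurable X) {C : ℝ}
    (hint : Integrable (fun ω => (X ω : ℝ)) P) (h : ∀ᵐ ω ∂P, (X ω : ℝ) ≤ C) :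
    ∫ ω, (X ω : ℝ) ^ 2 ∂P ≤ C * ∫ ω, (X ω : ℝ) ∂P := by
  rw [← integral_const_mul]
  refine integral_mono_ae (integrable_sq_of_le hX h) (hint.const_mul C) ?_
  filter_upwards [h] with ω hω
  rw [pow_two]
  gcongr

/-- A law of large numbers in the mean. -/
lemma tendsto_integral_abs_degreeBound_sub (hYmeas : ∀ t, Measurable (Y t))
    (hYindep : iIndepFun Y P) {μ : ℝ} (hμ : 0 ≤ μ)
    (hYint : ∀ t, 1 ≤ t → Integrable (fun ω => (Y t ω : ℝ)) P)
    (hYmean : ∀ t, 1 ≤ t → ∫ ω, (Y t ω : ℝ) ∂P = μ)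
    (hYbound : ∀ᶠ t : ℕ in atTop, ∀ᵐ ω ∂P, (Y t ω : ℝ) ≤ (t : ℝ) ^ (1 / 3 : ℝ)) :
    Tendsto (fun t : ℕ => (∫ ω, |degreeBound (fun i => Y i ω) t - μ * t| ∂P) / t) atTop (𝓝 0) := by
  obtain ⟨t₀, ht₀⟩ := eventually_atTop.1 hYbound
  set C := ∫ ω, |1 + ∑ i ∈ Finset.range t₀, ((Y (i + 1) ω : ℝ) - μ)| ∂P with hC
  have hbound : ∀ t : ℕ, t₀ + 1 ≤ t → ∫ ω, |degreeBound (fun i => Y i ω) t - μ * t| ∂P ≤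
      C + (μ + 1) / 2 * (t : ℝ) ^ (2 / 3 : ℝ) := by
    intro t ht
    have htpos : (0 : ℝ) < t := by exact_mod_cast (by omega : 0 < t)
    set X : ℕ → Ω → ℝ := fun i ω => (Y (i + 1) ω : ℝ) with hX
    set Z : Ω → ℝ := ∑ i ∈ Finset.Ico t₀ t, X i with hZ
    have hXb : ∀ i, t₀ ≤ i → ∀ᵐ ω ∂P, (Y (i + 1) ω : ℝ) ≤ ((i + 1 : ℕ) : ℝ) ^ (1 / 3 : ℝ) :=
      fun i hi => ht₀ (i + 1) (by omega)
    have hXmeas : ∀ i, Measurable (X i) := fun i =>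
      (measurable_of_countable (fun n : ℕ => (n : ℝ))).comp (hYmeas (i + 1))
    have hXLp : ∀ i ∈ Finset.Ico t₀ t, MemLp (X i) 2 P := fun i hi =>
      (memLp_two_iff_integrable_sq (hXmeas i).aestronglyMeasurable).2
        (integrable_sq_of_le (hYmeas (i + 1)) (hXb i (Finset.mem_Ico.1 hi).1))
    have hZLp : MemLp Z 2 P := memLp_finsetSum' _ hXLp
    have hvar : Var[Z; P] ≤ μ * (t : ℝ) ^ (4 / 3 : ℝ) := by
      rw [hZ, IndepFun.variance_sum hXLp fun i _ j _ hij =>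
        (hYindep.indepFun (by omega : i + 1 ≠ j + 1)).comp
          (measurable_of_countable (fun n : ℕ => (n : ℝ)))
          (measurable_of_countable (fun n : ℕ => (n : ℝ)))]
      calc ∑ i ∈ Finset.Ico t₀ t, Var[X i; P]
          ≤ ∑ i ∈ Finset.Ico t₀ t, (t : ℝ) ^ (1 / 3 : ℝ) * μ := by
            refine Finset.sum_le_sum fun i hi => ?_
            have hi' := Finset.mem_Ico.1 hi
            have h1 := integral_sq_le (hYmeas (i + 1)) (hYint (i + 1) (by omega)) (hXb i hi'.1)
            rw [hYmean _ (by omega)] at h1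
            refine (variance_le_expectation_sq (hXmeas i).aestronglyMeasurable).trans
              (h1.trans ?_)
            gcongr
            omega
        _ = ((t - t₀ : ℕ) : ℝ) * ((t : ℝ) ^ (1 / 3 : ℝ) * μ) := by simp
        _ ≤ t * ((t : ℝ) ^ (1 / 3 : ℝ) * μ) := by
            gcongr
            omega
        _ = μ * (t : ℝ) ^ (4 / 3 : ℝ) := by
            rw [show (4 / 3 : ℝ) = 1 + 1 / 3 by norm_num, Real.rpow_add htpos, Real.rpow_one]
            ring
    have hZmean : ∫ ω, Z ω ∂P = ((t - t₀ : ℕ) : ℝ) * μ := by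
      simp only [hZ, Finset.sum_apply]
      rw [integral_finsetSum _ fun i _ => hYint (i + 1) (by omega)]
      simp only [hYmean _ (Nat.succ_pos _)]
      simp
    have hsq : ∫ ω, (Z ω - ((t - t₀ : ℕ) : ℝ) * μ) ^ 2 ∂P ≤ μ * (t : ℝ) ^ (4 / 3 : ℝ) := by
      rw [variance_eq_integral hZLp.aestronglyMeasurable.aemeasurable, hZmean] at hvar
      exact hvar
    have hZint2 : Integrable (fun ω => (Z ω - ((t - t₀ : ℕ) : ℝ) * μ) ^ 2) P :=
      (hZLp.sub (memLp_const _)).integrable_sq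
    set l : ℝ := (t : ℝ) ^ (2 / 3 : ℝ) with hl
    have hl0 : 0 < l := Real.rpow_pos_of_pos htpos _
    have hll : (t : ℝ) ^ (4 / 3 : ℝ) = l * l := by
      rw [hl, ← Real.rpow_add htpos]
      norm_num
    have hint1 : Integrable (fun ω => |1 + ∑ i ∈ Finset.range t₀, ((Y (i + 1) ω : ℝ) - μ)|) P :=
      ((integrable_const _).add (integrable_finsetSum _ fun i _ =>
        (hYint (i + 1) (by omega)).sub (integrable_const _))).abs
    have hint2 : Integrable
        (fun ω => (Z ω - ((t - t₀ : ℕ) : ℝ) * μ) ^ 2 * (1 / (2 * l)) + l / 2) P :=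
      (hZint2.mul_const _).add (integrable_const _)
    have hpt : ∀ ω, |degreeBound (fun i => Y i ω) t - μ * t| ≤
        |1 + ∑ i ∈ Finset.range t₀, ((Y (i + 1) ω : ℝ) - μ)| +
          ((Z ω - ((t - t₀ : ℕ) : ℝ) * μ) ^ 2 * (1 / (2 * l)) + l / 2) := by
      intro ω
      have h1 : degreeBound (fun i => Y i ω) t - μ * t =
          (1 + ∑ i ∈ Finset.range t₀, ((Y (i + 1) ω : ℝ) - μ)) +
            (Z ω - ((t - t₀ : ℕ) : ℝ) * μ) := by
        rw [degreeBound, ← Finset.sum_range_add_sum_Ico _ (by omega : t₀ ≤ t), hZ,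
          Finset.sum_apply, Finset.sum_sub_distrib, Nat.cast_sub (by omega)]
        simp only [hX, Finset.sum_const, Finset.card_range, nsmul_eq_mul]
        ring
      rw [h1]
      refine (abs_add_le _ _).trans (add_le_add le_rfl ?_)
      set w := Z ω - ((t - t₀ : ℕ) : ℝ) * μ
      have h2 : w ^ 2 * (1 / (2 * l)) + l / 2 - |w| = (|w| - l) ^ 2 / (2 * l) := by
        rw [← sq_abs w]
        field_simp
        ring
      have h3 : 0 ≤ (|w| - l) ^ 2 / (2 * l) := by positivity
      linarith
    calc ∫ ω, |degreeBound (fun i => Y i ω) t - μ * t| ∂P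
        ≤ ∫ ω, (|1 + ∑ i ∈ Finset.range t₀, ((Y (i + 1) ω : ℝ) - μ)| +
          ((Z ω - ((t - t₀ : ℕ) : ℝ) * μ) ^ 2 * (1 / (2 * l)) + l / 2)) ∂P :=
          integral_mono ((integrable_degreeBound hYint t).sub (integrable_const _)).abs
            (hint1.add hint2) hpt
      _ = C + ((∫ ω, (Z ω - ((t - t₀ : ℕ) : ℝ) * μ) ^ 2 ∂P) * (1 / (2 * l)) + l / 2) := by
          rw [integral_add hint1 hint2,
            integral_add (hZint2.mul_const _) (integrable_const _), integral_mul_const]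
          simp [hC]
      _ ≤ C + (μ * (l * l) * (1 / (2 * l)) + l / 2) := by
          rw [← hll]
          gcongr
      _ = C + (μ + 1) / 2 * l := by
          field_simp
  have hlim : Tendsto (fun t : ℕ => C / t + (μ + 1) / 2 * (t : ℝ) ^ (-(1 / 3) : ℝ)) atTop (𝓝 0) := by
    have h1 : Tendsto (fun t : ℕ => (t : ℝ) ^ (-(1 / 3) : ℝ)) atTop (𝓝 0) :=
      (tendsto_rpow_neg_atTop (by norm_num)).comp tendsto_natCast_atTop_atTop
    simpa using (tendsto_const_div_atTop_nhds_zero_nat C).add (h1.const_mul ((μ + 1) / 2))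
  refine squeeze_zero' (Eventually.of_forall fun t => ?_) ?_ hlim
  · exact div_nonneg (integral_nonneg fun ω => abs_nonneg _) (Nat.cast_nonneg _)
  · filter_upwards [eventually_ge_atTop (t₀ + 1)] with t ht
    have htpos : (0 : ℝ) < t := by exact_mod_cast (by omega : 0 < t)
    rw [div_le_iff₀ htpos]
    refine (hbound t ht).trans_eq ?_
    rw [show (2 / 3 : ℝ) = -(1 / 3) + 1 by norm_num, Real.rpow_add htpos, Real.rpow_one]
    field_simp

end Random

end MHypergraph

lemma GrowsAtLeast.mono {a b : ℕ → ℝ} {A : ℝ} (ha : GrowsAtLeast a A) (h : ∀ t, a t ≤ b t) :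
    GrowsAtLeast b A :=
  fun ε hε => (ha ε hε).mono fun t ht => ht.trans (h t)

lemma GrowsAtLeast.add {a b : ℕ → ℝ} {A B : ℝ} (ha : GrowsAtLeast a A) (hb : GrowsAtLeast b B) :
    GrowsAtLeast (fun t => a t + b t) (A + B) := by
  intro ε hε
  filter_upwards [ha (ε / 2) (half_pos hε), hb (ε / 2) (half_pos hε)] with t h1 h2
  linarith

lemma growsAtLeast_mul (A : ℝ) : GrowsAtLeast (fun t => A * t) A := fun ε hε =>
  Eventually.of_forall fun t => by
    have : 0 ≤ ε * t := by positivity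
    linarith

lemma GrowsAtLeast.sum {a : ℕ → ℕ → ℝ} {A : ℕ → ℝ} (h : ∀ n, GrowsAtLeast (a n) (A n)) (K : ℕ) :
    GrowsAtLeast (fun t => ∑ n ∈ Finset.range K, a n t) (∑ n ∈ Finset.range K, A n) := by
  induction K with
  | zero => simpa using growsAtLeast_mul 0
  | succ K ih =>
    simp only [Finset.sum_range_succ]
    exact ih.add (h K)

lemma GrowsAtLeast.of_tendsto {a : ℕ → ℝ} {A : ℕ → ℝ} {L : ℝ} (hA : Tendsto A atTop (𝓝 L))
    (h : ∀ K, GrowsAtLeast a (A K)) : GrowsAtLeast a L := by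
  intro ε hε
  obtain ⟨K, hK⟩ := (hA.eventually_const_lt (by linarith : L - ε / 2 < L)).exists
  filter_upwards [h K (ε / 2) (half_pos hε)] with t ht
  refine le_trans (mul_le_mul_of_nonneg_right ?_ (Nat.cast_nonneg t)) ht
  linarith

lemma tendsto_rpow_third_div : Tendsto (fun t : ℕ => ((t + 1 : ℕ) : ℝ) ^ (1 / 3 : ℝ) / (t + 1))
    atTop (𝓝 0) := by
  have h1 : Tendsto (fun t : ℕ => ((t + 1 : ℕ) : ℝ) ^ (-(2 / 3) : ℝ)) atTop (𝓝 0) :=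
    ((tendsto_rpow_neg_atTop (by norm_num)).comp tendsto_natCast_atTop_atTop).comp
      (tendsto_add_atTop_nat 1)
  refine h1.congr fun t => ?_
  have h2 : (0 : ℝ) < ((t + 1 : ℕ) : ℝ) := by positivity
  rw [show (-(2 / 3) : ℝ) = 1 / 3 - 1 by norm_num, Real.rpow_sub_one h2.ne']
  push_cast
  rfl

namespace MHypergraph

/-- The conditions on the random hyperedge cardinalities. -/
structure IsCardinalityProcess {Ω : Type*} [MeasurableSpace Ω] (P : Measure Ω) (Y : ℕ → Ω → ℕ)
    (μ : ℝ) : Prop where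
  measurable : ∀ t, Measurable (Y t)
  indep : iIndepFun Y P
  two_le : ∀ᵐ ω ∂P, ∀ t, 2 ≤ Y t ω
  integrable : ∀ t, 1 ≤ t → Integrable (fun ω => (Y t ω : ℝ)) P
  mean : ∀ t, 1 ≤ t → ∫ ω, (Y t ω : ℝ) ∂P = μ
  le_rpow : ∀ᶠ t : ℕ in atTop, ∀ᵐ ω ∂P, (Y t ω : ℝ) ≤ (t : ℝ) ^ (1 / 3 : ℝ)

/-- The expectation of `f` at time `t`, averaged over the cardinalities. -/
def meanExp {Ω : Type*} [MeasurableSpace Ω] (P : Measure Ω) (p : ℝ) (Y : ℕ → Ω → ℕ)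
    (f : MHypergraph → ℝ) (t : ℕ) : ℝ := ∫ ω, lawExp p (fun i => Y i ω) t f ∂P

section Mean

variable {Ω : Type*} [MeasurableSpace Ω] {P : Measure Ω} [IsProbabilityMeasure P]
  {Y : ℕ → Ω → ℕ} {μ : ℝ} (hY : IsCardinalityProcess P Y μ) {p : ℝ} (hp0 : 0 ≤ p) (hp1 : p ≤ 1)

include hY

lemma IsCardinalityProcess.two_le_mean : 2 ≤ μ := by
  rw [← hY.mean 1 le_rfl]
  calc (2 : ℝ) = ∫ _ω, (2 : ℝ) ∂P := by simp
    _ ≤ _ := integral_mono_ae (integrable_const _) (hY.integrable 1 le_rfl) <| by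
      filter_upwards [hY.two_le] with ω hω
      exact_mod_cast hω 1

lemma integrable_lawExp {t : ℕ} {f : MHypergraph → ℝ} {C : ℝ}
    (h : ∀ y : ℕ → ℕ, (∀ i, 2 ≤ y i) → |lawExp p y t f| ≤ C) :
    Integrable (fun ω => lawExp p (fun i => Y i ω) t f) P := by
  refine Integrable.of_bound (C := C) (measurable_lawExp hY.measurable p t f).aestronglyMeasurable ?_
  filter_upwards [hY.two_le] with ω hω
  exact h _ hω

include hp0 hp1

lemma integrable_lawExp_tailCount (n t : ℕ) :
    Integrable (fun ω => lawExp p (fun i => Y i ω) t (tailCount n)) P :=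
  integrable_lawExp hY fun _ hy => abs_lawExp_tailCount_le hp0 hp1 hy n t

lemma integrable_lawExp_levelCount (n t : ℕ) :
    Integrable (fun ω => lawExp p (fun i => Y i ω) t (levelCount n)) P :=
  integrable_lawExp hY fun _ hy => abs_lawExp_levelCount_le hp0 hp1 hy n t

lemma integrable_lawExp_levelRatio (n t : ℕ) :
    Integrable (fun ω => lawExp p (fun i => Y i ω) t (levelRatio n)) P :=
  integrable_lawExp hY fun _ hy => abs_lawExp_levelRatio_le hp0 hp1 hy n t

lemma integrable_lawExp_totalDegree (t : ℕ) :
    Integrable (fun ω => lawExp p (fun i => Y i ω) t (fun H => (H.totalDegree : ℝ))) P := by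
  refine (integrable_degreeBound hY.integrable t).mono'
    (measurable_lawExp hY.measurable p t _).aestronglyMeasurable ?_
  filter_upwards [hY.two_le] with ω hω
  rw [Real.norm_of_nonneg (lawExp_totalDegree_nonneg hp0 hp1 hω t)]
  exact lawExp_totalDegree_le hp0 hp1 hω t

lemma meanExp_tailCount_zero (t : ℕ) : meanExp P p Y (tailCount 0) t = 1 + p * t := by
  have h : (fun ω => lawExp p (fun i => Y i ω) t (tailCount 0)) =ᵐ[P] fun _ => 1 + p * t := by
    filter_upwards [hY.two_le] with ω hω
    exact lawExp_tailCount_zero hp0 hp1 hω t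
  rw [meanExp, integral_congr_ae h]
  simp

lemma meanExp_levelCount_succ (n t : ℕ) : meanExp P p Y (levelCount (n + 1)) t =
    meanExp P p Y (tailCount n) t - meanExp P p Y (tailCount (n + 1)) t := by
  have h : levelCount (n + 1) = tailCount n - tailCount (n + 1) :=
    funext fun H => levelCount_succ n H
  simp only [meanExp, h, map_sub]
  exact integral_sub (integrable_lawExp_tailCount hY hp0 hp1 _ _)
    (integrable_lawExp_tailCount hY hp0 hp1 _ _)

lemma sum_meanExp_tailCount_le (K t : ℕ) :
    ∑ n ∈ Finset.range K, meanExp P p Y (tailCount n) t ≤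
      meanExp P p Y (fun H => (H.totalDegree : ℝ)) t := by
  unfold meanExp
  rw [← integral_finsetSum _ fun n _ => integrable_lawExp_tailCount hY hp0 hp1 n t]
  refine integral_mono_ae (integrable_finsetSum _ fun n _ =>
    integrable_lawExp_tailCount hY hp0 hp1 n t) (integrable_lawExp_totalDegree hY hp0 hp1 t) ?_
  filter_upwards [hY.two_le] with ω hω
  exact sum_lawExp_tailCount_le hp0 hp1 hω K t

lemma meanExp_totalDegree_le (t : ℕ) :
    meanExp P p Y (fun H => (H.totalDegree : ℝ)) t ≤ 1 + μ * t := by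
  rw [← integral_degreeBound hY.integrable hY.mean t]
  refine integral_mono_ae (integrable_lawExp_totalDegree hY hp0 hp1 t)
    (integrable_degreeBound hY.integrable t) ?_
  filter_upwards [hY.two_le] with ω hω
  exact lawExp_totalDegree_le hp0 hp1 hω t

lemma abs_meanExp_tailCount_increment_le {n t : ℕ} (hnt : n ≤ t) {C : ℝ}
    (hC : ∀ᵐ ω ∂P, (Y (t + 1) ω : ℝ) ≤ C) :
    |meanExp P p Y (tailCount (n + 1)) (t + 1) - meanExp P p Y (tailCount (n + 1)) t -
      (μ - p) * ((n + 1) * meanExp P p Y (levelRatio n) t)| ≤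
      C * μ * ((n + 1) ^ 2 / (t + 1)) := by
  have hYi := hY.integrable (t + 1) (by omega)
  have hLi := integrable_lawExp_levelRatio hY hp0 hp1 n t
  have hind := indepFun_lawExp hY.measurable hY.indep p t (levelRatio n) (fun m => (m : ℝ))
  have hprod : Integrable (fun ω => (Y (t + 1) ω : ℝ) *
      lawExp p (fun i => Y i ω) t (levelRatio n)) P := hind.symm.integrable_mul hYi hLi
  have hmul : ∫ ω, (Y (t + 1) ω : ℝ) * lawExp p (fun i => Y i ω) t (levelRatio n) ∂P =
      μ * meanExp P p Y (levelRatio n) t := by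
    rw [hind.symm.integral_fun_mul_eq_mul_integral hYi.aestronglyMeasurable
      hLi.aestronglyMeasurable, hY.mean _ (by omega), meanExp]
  have hdrift : ∀ ω, ((Y (t + 1) ω : ℝ) - p) *
      ((n + 1) * lawExp p (fun i => Y i ω) t (levelRatio n)) =
      (n + 1) * ((Y (t + 1) ω : ℝ) * lawExp p (fun i => Y i ω) t (levelRatio n) -
        p * lawExp p (fun i => Y i ω) t (levelRatio n)) := fun ω => by ring
  have hdi : Integrable (fun ω => ((Y (t + 1) ω : ℝ) - p) *
      ((n + 1) * lawExp p (fun i => Y i ω) t (levelRatio n))) P := by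
    simp only [hdrift]
    exact (hprod.sub (hLi.const_mul p)).const_mul _
  have hdm : ∫ ω, ((Y (t + 1) ω : ℝ) - p) *
      ((n + 1) * lawExp p (fun i => Y i ω) t (levelRatio n)) ∂P =
      (μ - p) * ((n + 1) * meanExp P p Y (levelRatio n) t) := by
    simp only [hdrift]
    rw [integral_const_mul, integral_sub hprod (hLi.const_mul p), hmul, integral_const_mul,
      ← meanExp]
    ring
  have hi1 := integrable_lawExp_tailCount hY hp0 hp1 (n + 1) (t + 1)
  have hi2 := integrable_lawExp_tailCount hY hp0 hp1 (n + 1) t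
  have hi12 : Integrable (fun ω => lawExp p (fun i => Y i ω) (t + 1) (tailCount (n + 1)) -
      lawExp p (fun i => Y i ω) t (tailCount (n + 1))) P := hi1.sub hi2
  have hsq := integral_sq_le (hY.measurable (t + 1)) hYi hC
  rw [hY.mean _ (by omega)] at hsq
  calc _ = |∫ ω, (lawExp p (fun i => Y i ω) (t + 1) (tailCount (n + 1)) -
        lawExp p (fun i => Y i ω) t (tailCount (n + 1)) - ((Y (t + 1) ω : ℝ) - p) *
          ((n + 1) * lawExp p (fun i => Y i ω) t (levelRatio n))) ∂P| := by
        rw [integral_sub hi12 hdi, integral_sub hi1 hi2, hdm]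
        rfl
    _ ≤ ∫ ω, |lawExp p (fun i => Y i ω) (t + 1) (tailCount (n + 1)) -
        lawExp p (fun i => Y i ω) t (tailCount (n + 1)) - ((Y (t + 1) ω : ℝ) - p) *
          ((n + 1) * lawExp p (fun i => Y i ω) t (levelRatio n))| ∂P :=
        abs_integral_le_integral_abs
    _ ≤ ∫ ω, (Y (t + 1) ω : ℝ) ^ 2 * ((n + 1) ^ 2 / (t + 1)) ∂P := by
        refine integral_mono_ae (hi12.sub hdi).abs
          ((integrable_sq_of_le (hY.measurable _) hC).mul_const _) ?_
        filter_upwards [hY.two_le] with ω hω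
        exact abs_lawExp_tailCount_increment_le hp0 hp1 hω hnt
    _ ≤ C * μ * ((n + 1) ^ 2 / (t + 1)) := by
        rw [integral_mul_const]
        gcongr

lemma le_meanExp_levelRatio {t : ℕ} (ht : 0 < t) (n : ℕ) :
    (meanExp P p Y (tailCount n) t - meanExp P p Y (tailCount (n + 1)) t) / (μ * t) -
      (∫ ω, |degreeBound (fun i => Y i ω) t - μ * t| ∂P) / (μ * t) ≤
      meanExp P p Y (levelRatio n) t := by
  have hμ : 0 < μ := by linarith [hY.two_le_mean]
  have h1 := integrable_lawExp_tailCount hY hp0 hp1 n t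
  have h2 := integrable_lawExp_tailCount hY hp0 hp1 (n + 1) t
  have h12 : Integrable (fun ω => (lawExp p (fun i => Y i ω) t (tailCount n) -
      lawExp p (fun i => Y i ω) t (tailCount (n + 1))) / (μ * t)) P := (h1.sub h2).div_const _
  have h3 : Integrable (fun ω => |degreeBound (fun i => Y i ω) t - μ * t| / (μ * t)) P :=
    ((integrable_degreeBound hY.integrable t).sub (integrable_const (μ * t))).abs.div_const _
  unfold meanExp
  rw [← integral_sub h1 h2, ← integral_div, ← integral_div,
    ← integral_sub h12 h3]
  refine integral_mono_ae (h12.sub h3)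
    (integrable_lawExp_levelRatio hY hp0 hp1 n t) ?_
  filter_upwards [hY.two_le] with ω hω
  exact le_lawExp_levelRatio hp0 hp1 hω hμ ht n

lemma meanExp_levelRatio_le {t : ℕ} (ht : 0 < t) (n : ℕ) :
    meanExp P p Y (levelRatio n) t ≤
      (meanExp P p Y (tailCount n) t - meanExp P p Y (tailCount (n + 1)) t) / (μ * t) +
      (∫ ω, |degreeBound (fun i => Y i ω) t - μ * t| ∂P) / (μ * t) +
      (1 + μ * t - meanExp P p Y (fun H => (H.totalDegree : ℝ)) t) / (t + 1) := by
  have hμ : 0 < μ := by linarith [hY.two_le_mean]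
  have h1 := integrable_lawExp_tailCount hY hp0 hp1 n t
  have h2 := integrable_lawExp_tailCount hY hp0 hp1 (n + 1) t
  have h12 : Integrable (fun ω => (lawExp p (fun i => Y i ω) t (tailCount n) -
      lawExp p (fun i => Y i ω) t (tailCount (n + 1))) / (μ * t)) P := (h1.sub h2).div_const _
  have h3 : Integrable (fun ω => |degreeBound (fun i => Y i ω) t - μ * t| / (μ * t)) P :=
    ((integrable_degreeBound hY.integrable t).sub (integrable_const (μ * t))).abs.div_const _
  have h4 := integrable_degreeBound hY.integrable t
  have h5 := integrable_lawExp_totalDegree hY hp0 hp1 t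
  have h123 : Integrable (fun ω => (lawExp p (fun i => Y i ω) t (tailCount n) -
      lawExp p (fun i => Y i ω) t (tailCount (n + 1))) / (μ * t) +
        |degreeBound (fun i => Y i ω) t - μ * t| / (μ * t)) P := h12.add h3
  have h45 : Integrable (fun ω => (degreeBound (fun i => Y i ω) t -
      lawExp p (fun i => Y i ω) t (fun H => (H.totalDegree : ℝ))) / (t + 1)) P :=
    (h4.sub h5).div_const _
  rw [← integral_degreeBound hY.integrable hY.mean t]
  unfold meanExp
  rw [← integral_sub h1 h2, ← integral_sub h4 h5, ← integral_div, ← integral_div, ← integral_div,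
    ← integral_add h12 h3, ← integral_add h123 h45]
  refine integral_mono_ae (integrable_lawExp_levelRatio hY hp0 hp1 n t)
    (h123.add h45) ?_
  filter_upwards [hY.two_le] with ω hω
  exact lawExp_levelRatio_le hp0 hp1 hω hμ ht n

/-- The error terms that do not involve the sum of the degrees. -/
lemma exists_error_bound (n : ℕ) : ∃ e : ℕ → ℝ, Tendsto e atTop (𝓝 0) ∧
    ∀ᶠ t : ℕ in atTop,
      (μ - p) * (n + 1) * ((∫ ω, |degreeBound (fun i => Y i ω) t - μ * t| ∂P) / (μ * t)) +
        |meanExp P p Y (tailCount (n + 1)) (t + 1) - meanExp P p Y (tailCount (n + 1)) t -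
          (μ - p) * ((n + 1) * meanExp P p Y (levelRatio n) t)| ≤ e t := by
  have hμ : 0 < μ := by linarith [hY.two_le_mean]
  refine ⟨fun t => (μ - p) * (n + 1) / μ *
    ((∫ ω, |degreeBound (fun i => Y i ω) t - μ * t| ∂P) / t) +
    μ * (n + 1) ^ 2 * (((t + 1 : ℕ) : ℝ) ^ (1 / 3 : ℝ) / (t + 1)), ?_, ?_⟩
  · simpa using ((tendsto_integral_abs_degreeBound_sub hY.measurable hY.indep hμ.le hY.integrable
      hY.mean hY.le_rpow).const_mul _).add (tendsto_rpow_third_div.const_mul _)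
  · filter_upwards [(tendsto_add_atTop_nat 1).eventually hY.le_rpow, eventually_ge_atTop n,
      eventually_gt_atTop 0] with t h1 h2 h3
    have h3' : (0 : ℝ) < t := by exact_mod_cast h3
    refine add_le_add (le_of_eq ?_)
      ((abs_meanExp_tailCount_increment_le hY hp0 hp1 h2 h1).trans_eq ?_)
    · field_simp
    · ring

lemma growsAtLeast_tailCount (n : ℕ) :
    GrowsAtLeast (meanExp P p Y (tailCount n)) (tailLimit p (μ / (μ - p)) n) := by
  have hμ : 2 ≤ μ := hY.two_le_mean
  have hμp : 0 < μ - p := by linarith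
  induction n with
  | zero =>
    rw [tailLimit_zero]
    refine (growsAtLeast_mul p).mono fun t => ?_
    rw [meanExp_tailCount_zero hY hp0 hp1]
    linarith
  | succ n ih =>
    obtain ⟨e, he, hbound⟩ := exists_error_bound hY hp0 hp1 n
    have hT : tailLimit p (μ / (μ - p)) (n + 1) = (n + 1) * (μ - p) / μ *
        tailLimit p (μ / (μ - p)) n / (1 + (n + 1) * (μ - p) / μ) := by
      have h1 : (n + 1) * (μ - p) + μ ≠ 0 := by positivity
      have h2 : μ + (n + 1) * (μ - p) ≠ 0 := by positivity
      rw [tailLimit_succ]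
      field_simp
      ring
    rw [hT]
    refine GrowsAtLeast.of_recursion (by positivity) ih he ?_
    filter_upwards [hbound, eventually_gt_atTop 0] with t h1 ht
    have ht' : (0 : ℝ) < t := by exact_mod_cast ht
    have h2 := mul_le_mul_of_nonneg_left (le_meanExp_levelRatio hY hp0 hp1 ht n)
      (by positivity : 0 ≤ (μ - p) * (n + 1))
    have h3 := neg_abs_le (meanExp P p Y (tailCount (n + 1)) (t + 1) -
      meanExp P p Y (tailCount (n + 1)) t - (μ - p) * ((n + 1) * meanExp P p Y (levelRatio n) t))
    have h4 : (n + 1) * (μ - p) / μ *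
        (meanExp P p Y (tailCount n) t - meanExp P p Y (tailCount (n + 1)) t) / t =
        (μ - p) * (n + 1) *
          ((meanExp P p Y (tailCount n) t - meanExp P p Y (tailCount (n + 1)) t) / (μ * t)) := by
      field_simp
    rw [h4]
    linarith

lemma tendsto_degree_loss (hp : 0 < p) :
    Tendsto (fun t : ℕ => (1 + μ * t - meanExp P p Y (fun H => (H.totalDegree : ℝ)) t) / (t + 1))
      atTop (𝓝 0) := by
  have hμ : 2 ≤ μ := hY.two_le_mean
  have hμp : 0 < μ - p := by linarith
  have hb : 1 < μ / (μ - p) := (one_lt_div hμp).2 (by linarith)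
  have hlim : p * (μ / (μ - p)) / (μ / (μ - p) - 1) = μ := by
    have h1 : μ / (μ - p) - 1 = p / (μ - p) := by
      field_simp
      ring
    rw [h1]
    field_simp
  have hsum := tendsto_sum_tailLimit (p := p) hb
  rw [hlim] at hsum
  have hgrow := GrowsAtLeast.of_tendsto hsum fun K =>
    (GrowsAtLeast.sum (growsAtLeast_tailCount hY hp0 hp1) K).mono
      (sum_meanExp_tailCount_le hY hp0 hp1 K)
  rw [Metric.tendsto_nhds]
  intro ε hε
  filter_upwards [hgrow (ε / 2) (half_pos hε), eventually_ge_atTop ⌈2 / ε⌉₊] with t h1 h2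
  have h3 : 2 / ε ≤ t := (Nat.le_ceil _).trans (by exact_mod_cast h2)
  rw [div_le_iff₀ hε] at h3
  have h4 := meanExp_totalDegree_le hY hp0 hp1 t
  rw [Real.dist_eq, sub_zero, abs_of_nonneg (div_nonneg (by linarith) (by positivity)),
    div_lt_iff₀ (by positivity)]
  nlinarith

lemma tendsto_meanExp_tailCount (hp : 0 < p) (n : ℕ) :
    Tendsto (fun t : ℕ => meanExp P p Y (tailCount n) t / t) atTop
      (𝓝 (tailLimit p (μ / (μ - p)) n)) := by
  have hμ : 2 ≤ μ := hY.two_le_mean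
  have hμp : 0 < μ - p := by linarith
  refine tendsto_div_of_growsAtLeast (growsAtLeast_tailCount hY hp0 hp1 n) ?_
  induction n with
  | zero =>
    rw [tailLimit_zero]
    intro ε hε
    filter_upwards [eventually_ge_atTop ⌈1 / ε⌉₊] with t h2
    have h3 : 1 / ε ≤ t := (Nat.le_ceil _).trans (by exact_mod_cast h2)
    rw [div_le_iff₀ hε] at h3
    rw [meanExp_tailCount_zero hY hp0 hp1]
    linarith
  | succ n ih =>
    obtain ⟨e, he, hbound⟩ := exists_error_bound hY hp0 hp1 n
    have hT : -tailLimit p (μ / (μ - p)) (n + 1) = (n + 1) * (μ - p) / μ *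
        -tailLimit p (μ / (μ - p)) n / (1 + (n + 1) * (μ - p) / μ) := by
      have h1 : (n + 1) * (μ - p) + μ ≠ 0 := by positivity
      have h2 : μ + (n + 1) * (μ - p) ≠ 0 := by positivity
      rw [tailLimit_succ]
      field_simp
      ring
    rw [hT]
    have he' := he.add ((tendsto_degree_loss hY hp0 hp1 hp).const_mul ((μ - p) * (n + 1)))
    rw [mul_zero, add_zero] at he'
    refine GrowsAtLeast.of_recursion (by positivity) ih he' ?_
    filter_upwards [hbound, eventually_gt_atTop 0] with t h1 ht
    have ht' : (0 : ℝ) < t := by exact_mod_cast ht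
    have h2 := mul_le_mul_of_nonneg_left (meanExp_levelRatio_le hY hp0 hp1 ht n)
      (by positivity : 0 ≤ (μ - p) * (n + 1))
    have h3 := le_abs_self (meanExp P p Y (tailCount (n + 1)) (t + 1) -
      meanExp P p Y (tailCount (n + 1)) t - (μ - p) * ((n + 1) * meanExp P p Y (levelRatio n) t))
    have h4 : (n + 1) * (μ - p) / μ *
        (-meanExp P p Y (tailCount n) t - -meanExp P p Y (tailCount (n + 1)) t) / t =
        -((μ - p) * (n + 1) *
          ((meanExp P p Y (tailCount n) t - meanExp P p Y (tailCount (n + 1)) t) / (μ * t))) := by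
      field_simp
      ring
    rw [h4]
    linarith

end Mean

lemma expectedDegreeCount_eq {Ω : Type*} [MeasurableSpace Ω] {P : Measure Ω}
    [IsProbabilityMeasure P] {Y : ℕ → Ω → ℕ} {μ : ℝ} (hY : IsCardinalityProcess P Y μ)
    (p : ℝ≥0) (hp1 : p ≤ 1) (k t : ℕ) :
    expectedDegreeCount P p hp1 Y k t = ENNReal.ofReal (meanExp P p Y (levelCount k) t) := by
  have hp1' : (p : ℝ) ≤ 1 := by exact_mod_cast hp1
  have h : ∀ ω, ∑' H : MHypergraph, lawAt p hp1 (fun i => Y i ω) t H * (H.degreeCount k : ℝ≥0∞) =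
      ENNReal.ofReal (lawExp p (fun i => Y i ω) t (levelCount k)) := fun ω => by
    rw [← tsum_lawAt_mul p hp1 _ t (levelCount_nonneg k)]
    simp only [← degreeCount_eq_levelCount, ENNReal.ofReal_natCast]
  simp only [expectedDegreeCount, h]
  refine (ofReal_integral_eq_lintegral_ofReal
    (integrable_lawExp_levelCount hY p.coe_nonneg hp1' k t) ?_).symm
  filter_upwards [hY.two_le] with ω hω
  rw [Pi.zero_apply, ← lawExp_const p (fun i => Y i ω) t 0]
  exact lawExp_mono p.coe_nonneg hp1' hω fun H _ => levelCount_nonneg k H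

lemma meanExp_levelCount_nonneg {Ω : Type*} [MeasurableSpace Ω] {P : Measure Ω}
    {Y : ℕ → Ω → ℕ} {μ : ℝ} (hY : IsCardinalityProcess P Y μ) {p : ℝ} (hp0 : 0 ≤ p) (hp1 : p ≤ 1)
    (k t : ℕ) : 0 ≤ meanExp P p Y (levelCount k) t := by
  refine integral_nonneg_of_ae ?_
  filter_upwards [hY.two_le] with ω hω
  rw [Pi.zero_apply, ← lawExp_const p (fun i => Y i ω) t 0]
  exact lawExp_mono hp0 hp1 hω fun H _ => levelCount_nonneg k H

end MHypergraph

end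

theorem theorem1 {Ω : Type*} [MeasurableSpace Ω] (P : Measure Ω) [IsProbabilityMeasure P]
    (p : ℝ≥0) (hp0 : 0 < p) (hp1 : p ≤ 1)
    (Y : ℕ → Ω → ℕ) (hYmeas : ∀ t, Measurable (Y t)) (hYindep : iIndepFun Y P)
    (hYtwo : ∀ t, ∀ᵐ ω ∂P, 2 ≤ Y t ω)
    (μ : ℝ) (hYint : ∀ t, 1 ≤ t → Integrable (fun ω => (Y t ω : ℝ)) P)
    (hYmean : ∀ t, 1 ≤ t → ∫ ω, (Y t ω : ℝ) ∂P = μ)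
    (hYbound : ∀ᶠ t : ℕ in atTop, ∀ᵐ ω ∂P,
      2 < Y t ω ∧ (Y t ω : ℝ) < (t : ℝ) ^ (1 / 3 : ℝ)) :
    (∀ k t : ℕ, MHypergraph.expectedDegreeCount P p hp1 Y k t ≠ ∞) ∧
    ∃ M : ℕ → ℝ,
      (∀ k : ℕ, 1 ≤ k →
        Tendsto (fun t : ℕ => (MHypergraph.expectedDegreeCount P p hp1 Y k t).toReal / (t : ℝ))
          atTop (𝓝 (M k))) ∧
      M 1 = μ * (p : ℝ) / (2 * μ - (p : ℝ)) ∧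
      (∀ k : ℕ, 2 ≤ k →
        M k = M (k - 1) * ((k : ℝ) - 1) / ((k : ℝ) + μ / (μ - (p : ℝ)))) ∧
      FollowsPowerLaw M (2 + (p : ℝ) / (μ - (p : ℝ))) := by
  have hY : MHypergraph.IsCardinalityProcess P Y μ :=
    ⟨hYmeas, hYindep, ae_all_iff.2 hYtwo, hYint, hYmean,
      hYbound.mono fun t ht => ht.mono fun ω hω => hω.2.le⟩
  have hp0' : (0 : ℝ) < p := by exact_mod_cast hp0
  have hp1' : (p : ℝ) ≤ 1 := by exact_mod_cast hp1
  have hμ : 2 ≤ μ := hY.two_le_mean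
  have hμp : 0 < μ - p := by linarith
  set b := μ / (μ - p) with hb
  have hb0 : 0 < b := by positivity
  refine ⟨fun k t => ?_, fun k => tailLimit p b (k - 1) - tailLimit p b k, fun k hk => ?_, ?_,
    fun k hk => ?_, ?_⟩
  · rw [MHypergraph.expectedDegreeCount_eq hY]
    exact ENNReal.ofReal_ne_top
  · obtain ⟨n, rfl⟩ : ∃ n, k = n + 1 := ⟨k - 1, by omega⟩
    have h : ∀ t : ℕ, (MHypergraph.expectedDegreeCount P p hp1 Y (n + 1) t).toReal / (t : ℝ) =
        MHypergraph.meanExp P p Y (MHypergraph.tailCount n) t / t -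
          MHypergraph.meanExp P p Y (MHypergraph.tailCount (n + 1)) t / t := fun t => by
      rw [MHypergraph.expectedDegreeCount_eq hY, ENNReal.toReal_ofReal
        (MHypergraph.meanExp_levelCount_nonneg hY p.coe_nonneg hp1' _ _),
        MHypergraph.meanExp_levelCount_succ hY p.coe_nonneg hp1', sub_div]
    simp only [h, Nat.add_sub_cancel]
    exact (MHypergraph.tendsto_meanExp_tailCount hY p.coe_nonneg hp1' hp0' n).sub
      (MHypergraph.tendsto_meanExp_tailCount hY p.coe_nonneg hp1' hp0' (n + 1))
  · have h := tailLimit_sub_succ (p := p) hb0 0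
    have h1 : 2 * μ - p ≠ 0 := by linarith
    have h2 : 0 + 1 + b = (2 * μ - p) / (μ - p) := by
      rw [hb]
      field_simp
      ring
    refine h.trans ?_
    rw [tailLimit_zero, Nat.cast_zero, h2, hb]
    field_simp
  · obtain ⟨n, rfl⟩ : ∃ n, k = n + 2 := ⟨k - 2, by omega⟩
    have h1 : (n + 1 + b : ℝ) ≠ 0 := by positivity
    have h2 : (n + 2 + b : ℝ) ≠ 0 := by positivity
    have h3 : (n + 1 + 1 + b : ℝ) ≠ 0 := by positivity
    simp only [show n + 2 - 1 = n + 1 by omega, Nat.add_sub_cancel]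
    rw [tailLimit_sub_succ hb0 n, show n + 2 = n + 1 + 1 from rfl, tailLimit_sub_succ hb0 (n + 1),
      tailLimit_succ]
    push_cast
    field_simp
    ring
  · have h : 2 + (p : ℝ) / (μ - p) = 1 + b := by
      rw [hb]
      field_simp
      ring
    rw [h]
    exact followsPowerLaw_tailLimit hp0' hb0
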